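/- **Stochastic knapsack with unlimited copies (SK-U).** An instance consists of a capacity $C\ge 0$ and finitely many item types $b_1,\dots,b_n$. Each item type is given by an explicitly listed, finitely supported joint probability distribution of a non-negative size and a non-negative profit, i.e. by a finite list of outcomes (size, probability, profit). Unlimited independent copies of every item type are available. An adaptive policy repeatedly stops or selects an item type, depending on everything realized so far; a fresh copy is inserted, and its size and profit are revealed. If its size is at most the remaining capacity, the profit is collected and the capacity is reduced by the size; otherwise the process ends, without the profit of that copy. Let $\mathsf{OPT}\in[0,\infty]$ be the supremum of the expected total profit over all adaptive policies with capacity $C$. A *canonical policy* is given by a bound $L\in\mathbb N$, a table that assigns to every $s\in\{0,\dots,L\}$ an item type or "stop", and, for every outcome of every item type, a discretized size: a number in $\mathbb N$ (a multiple of a grid unit), or two such numbers between which a coin flip with a prescribed probability decides. It makes its decision from the total discretized size $s$ of the copies inserted so far, and stops when $s>L$; its profit is still determined by the actual sizes. **Theorem.** There is a linear-time FPTAS for SK-U when the capacity is relaxed to $C+\varepsilon$. That is: there are constants $K,k\in\mathbb N$ and a single algorithm (a program for the unit-cost real RAM: exact arithmetic on reals, natural-number indices, no rounding operation) that, for every instance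 and every $\varepsilon>0$, halts after at most $$K\cdot N\cdot\bigl((1+C)(1+1/\varepsilon)\bigr)^{k}$$ steps, where $N$ is the input size (the number of numbers needed to list the instance and $\varepsilon$), and outputs a canonical policy whose expected total profit on the original instance with capacity $C+\varepsilon$ is at least $(1-\varepsilon)\,\mathsf{OPT}$ (for $\varepsilon\ge 1$ the factor $1-\varepsilon$ is read as $0$). In particular, for $C$ bounded by a constant, e.g. $\tfrac12\le C\le 2$, the running time is linear in the input size and polynomial in $1/\varepsilon$. -/

import Mathlib

noncomputable section

/-! ### Stochastic knapsack with unlimited copies -/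

namespace StochKnapsack

/-- One possible outcome of inserting a copy of an item: the size and the profit that are
realized, and the probability of this outcome. -/
structure Atom where
  size : ℝ
  prob : ℝ
  profit : ℝ

/-- An item is its joint distribution of size and profit, given by the list of its outcomes. -/
abbrev Item := List Atom

/-- An instance: the item types (unlimited independent copies of each are available) and the
capacity of the knapsack. -/
structure Instance where
  items : List Item
  capacity : ℝ

/-- The `i`-th item type (the empty list if there is none). -/
def Instance.item (I : Instance) (i : ℕ) : Item := I.items.getD i []

/-- The `j`-th outcome of the `i`-th item type. -/
def Instance.outcome (I : Instance) (i j : ℕ) : Atom := (I.item i).getD j ⟨0, 0, 0⟩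

/-- Sizes, profits and the capacity are non-negative; each item is a probability distribution. -/
structure Instance.Valid (I : Instance) : Prop where
  capacity_nonneg : 0 ≤ I.capacity
  size_nonneg : ∀ b ∈ I.items, ∀ a ∈ b, 0 ≤ a.size
  prob_nonneg : ∀ b ∈ I.items, ∀ a ∈ b, 0 ≤ a.prob
  profit_nonneg : ∀ b ∈ I.items, ∀ a ∈ b, 0 ≤ a.profit
  prob_sum : ∀ b ∈ I.items, (b.map Atom.prob).sum = 1

/-- The number of numbers needed to write down an instance and an accuracy: the number of items,
the capacity, the accuracy, the number of outcomes of each item, and three reals per outcome. -/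
def Instance.inputSize (I : Instance) : ℕ :=
  3 + (I.items.map fun b => 1 + 3 * b.length).sum

/-- An adaptive policy (a possibly infinite decision tree).  Given the history of insertions, most
recent first, each recorded as (item, index of its realized outcome), it stops (`none`) or names
the item whose copy is inserted next. -/
abbrev Policy := List (ℕ × ℕ) → Option ℕ

/-- Expected profit that `σ` collects with its next `k` insertions, after the history `h` and with
remaining capacity `c`.  An insertion that overflows the knapsack ends the game without profit. -/
def profitWithin (I : Instance) (σ : Policy) : ℕ → List (ℕ × ℕ) → ℝ → ℝ
  | 0, _, _ => 0
  | k + 1, h, c =>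
    match σ h with
    | none => 0
    | some i =>
      ∑ j ∈ Finset.range (I.item i).length,
        if (I.outcome i j).size ≤ c then
          (I.outcome i j).prob *
            ((I.outcome i j).profit +
              profitWithin I σ k ((i, j) :: h) (c - (I.outcome i j).size))
        else 0

/-- Expected total profit of `σ` with capacity `c`; it is infinite for instance if an item of size
zero and positive profit is inserted forever. -/
def expectedProfit (I : Instance) (σ : Policy) (c : ℝ) : ENNReal :=
  ⨆ k : ℕ, ENNReal.ofReal (profitWithin I σ k [] c)

/-- Optimal expected profit over all adaptive policies, for the unrelaxed capacity. -/
def OPT (I : Instance) : ENNReal :=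
  ⨆ σ : Policy, expectedProfit I σ I.capacity

/-- A canonical policy: it decides on the basis of the total discretized size `s` of the copies
inserted so far, and stops as soon as `s` exceeds `bound`.  The discretized size (in units of the
grid) of outcome `j` of item `i` is `hi i j` with probability `up i j` and `lo i j` otherwise, by
an independent coin flip; this splits the mass of an outcome between two discretized sizes. -/
structure CanonicalPolicy where
  bound : ℕ
  insert : ℕ → Option ℕ
  lo : ℕ → ℕ → ℕ
  hi : ℕ → ℕ → ℕ
  up : ℕ → ℕ → ℝ

/-- The coin flips of the discretization are honest probabilities. -/
def CanonicalPolicy.WellFormed (I : Instance) (ρ : CanonicalPolicy) : Prop :=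
  ∀ i j : ℕ, j < (I.item i).length → 0 ≤ ρ.up i j ∧ ρ.up i j ≤ 1

/-- Expected profit that the canonical policy collects on the original (not discretized) instance
with its next `k` insertions, from total discretized size `s` and remaining actual capacity `c`. -/
def CanonicalPolicy.profitWithin (I : Instance) (ρ : CanonicalPolicy) : ℕ → ℕ → ℝ → ℝ
  | 0, _, _ => 0
  | k + 1, s, c =>
    if ρ.bound < s then 0 else
      match ρ.insert s with
      | none => 0
      | some i =>
        ∑ j ∈ Finset.range (I.item i).length,
          if (I.outcome i j).size ≤ c then
            (I.outcome i j).prob *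
              ((I.outcome i j).profit +
                ((1 - ρ.up i j) *
                    ρ.profitWithin I k (s + ρ.lo i j) (c - (I.outcome i j).size) +
                  ρ.up i j *
                    ρ.profitWithin I k (s + ρ.hi i j) (c - (I.outcome i j).size)))
          else 0

/-- Expected total profit of a canonical policy on the original instance with capacity `c`. -/
def CanonicalPolicy.expectedProfit (I : Instance) (ρ : CanonicalPolicy) (c : ℝ) : ENNReal :=
  ⨆ k : ℕ, ENNReal.ofReal (ρ.profitWithin I k 0 c)

end StochKnapsack

/-! ### A unit-cost real random access machine

Structured programs over variables and arrays that hold natural numbers (counters, indices) or real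
numbers.  There is no rounding of reals; the only constants are natural numbers.  Every arithmetic
operation, memory access, comparison and assignment costs one step. -/

namespace RealRAM

/-- Memory: variables and zero-initialized arrays, each named by a number. -/
structure Store where
  nvar : ℕ → ℕ
  rvar : ℕ → ℝ
  narr : ℕ → ℕ → ℕ
  rarr : ℕ → ℕ → ℝ

/-- Expressions with natural values. -/
inductive NExp
  | lit (m : ℕ)
  | var (x : ℕ)
  | get (a : ℕ) (i : NExp)
  | add (e₁ e₂ : NExp)
  | sub (e₁ e₂ : NExp)
  | mul (e₁ e₂ : NExp)

/-- Expressions with real values. -/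
inductive RExp
  | ofNat (e : NExp)
  | var (x : ℕ)
  | get (a : ℕ) (i : NExp)
  | add (e₁ e₂ : RExp)
  | sub (e₁ e₂ : RExp)
  | mul (e₁ e₂ : RExp)
  | div (e₁ e₂ : RExp)

/-- Tests. -/
inductive BExp
  | nlt (e₁ e₂ : NExp)
  | rlt (e₁ e₂ : RExp)
  | not (b : BExp)
  | and (b₁ b₂ : BExp)

/-- Programs. -/
inductive Prog
  | setN (x : ℕ) (e : NExp)
  | setR (x : ℕ) (e : RExp)
  | putN (a : ℕ) (i : NExp) (e : NExp)
  | putR (a : ℕ) (i : NExp) (e : RExp)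
  | seq (p q : Prog)
  | ite (b : BExp) (p q : Prog)
  | loop (b : BExp) (p : Prog)

/-- Subtraction of natural numbers is truncated at zero. -/
def NExp.eval (s : Store) : NExp → ℕ
  | lit m => m
  | var x => s.nvar x
  | get a i => s.narr a (i.eval s)
  | add e₁ e₂ => e₁.eval s + e₂.eval s
  | sub e₁ e₂ => e₁.eval s - e₂.eval s
  | mul e₁ e₂ => e₁.eval s * e₂.eval s

/-- Division by zero returns zero. -/
def RExp.eval (s : Store) : RExp → ℝ
  | ofNat e => (e.eval s : ℝ)
  | var x => s.rvar x
  | get a i => s.rarr a (i.eval s)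
  | add e₁ e₂ => e₁.eval s + e₂.eval s
  | sub e₁ e₂ => e₁.eval s - e₂.eval s
  | mul e₁ e₂ => e₁.eval s * e₂.eval s
  | div e₁ e₂ => e₁.eval s / e₂.eval s

/-- The test `b` succeeds in the memory `s`. -/
def BExp.Holds (s : Store) : BExp → Prop
  | nlt e₁ e₂ => e₁.eval s < e₂.eval s
  | rlt e₁ e₂ => e₁.eval s < e₂.eval s
  | not b => ¬ b.Holds s
  | and b₁ b₂ => b₁.Holds s ∧ b₂.Holds s

def NExp.cost : NExp → ℕ
  | lit _ => 1
  | var _ => 1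
  | get _ i => i.cost + 1
  | add e₁ e₂ => e₁.cost + e₂.cost + 1
  | sub e₁ e₂ => e₁.cost + e₂.cost + 1
  | mul e₁ e₂ => e₁.cost + e₂.cost + 1

def RExp.cost : RExp → ℕ
  | ofNat e => e.cost + 1
  | var _ => 1
  | get _ i => i.cost + 1
  | add e₁ e₂ => e₁.cost + e₂.cost + 1
  | sub e₁ e₂ => e₁.cost + e₂.cost + 1
  | mul e₁ e₂ => e₁.cost + e₂.cost + 1
  | div e₁ e₂ => e₁.cost + e₂.cost + 1

def BExp.cost : BExp → ℕ
  | nlt e₁ e₂ => e₁.cost + e₂.cost + 1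
  | rlt e₁ e₂ => e₁.cost + e₂.cost + 1
  | not b => b.cost + 1
  | and b₁ b₂ => b₁.cost + b₂.cost + 1

/-- `Exec p s t s'`: started in memory `s`, the program `p` halts after exactly `t` steps in
memory `s'`.  (Execution is deterministic; a program that does not halt has no such run.) -/
inductive Exec : Prog → Store → ℕ → Store → Prop
  | setN (x : ℕ) (e : NExp) (s : Store) :
      Exec (.setN x e) s (e.cost + 1)
        { s with nvar := Function.update s.nvar x (e.eval s) }
  | setR (x : ℕ) (e : RExp) (s : Store) :
      Exec (.setR x e) s (e.cost + 1)
        { s with rvar := Function.update s.rvar x (e.eval s) }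
  | putN (a : ℕ) (i e : NExp) (s : Store) :
      Exec (.putN a i e) s (i.cost + e.cost + 1)
        { s with narr :=
            Function.update s.narr a (Function.update (s.narr a) (i.eval s) (e.eval s)) }
  | putR (a : ℕ) (i : NExp) (e : RExp) (s : Store) :
      Exec (.putR a i e) s (i.cost + e.cost + 1)
        { s with rarr :=
            Function.update s.rarr a (Function.update (s.rarr a) (i.eval s) (e.eval s)) }
  | seq {p q : Prog} {s s' s'' : Store} {t t' : ℕ} :
      Exec p s t s' → Exec q s' t' s'' → Exec (.seq p q) s (t + t') s''
  | ite_true {b : BExp} {p q : Prog} {s s' : Store} {t : ℕ} :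
      b.Holds s → Exec p s t s' → Exec (.ite b p q) s (b.cost + t + 1) s'
  | ite_false {b : BExp} {p q : Prog} {s s' : Store} {t : ℕ} :
      ¬ b.Holds s → Exec q s t s' → Exec (.ite b p q) s (b.cost + t + 1) s'
  | loop_done {b : BExp} {p : Prog} {s : Store} :
      ¬ b.Holds s → Exec (.loop b p) s (b.cost + 1) s
  | loop_step {b : BExp} {p : Prog} {s s' s'' : Store} {t t' : ℕ} :
      b.Holds s → Exec p s t s' → Exec (.loop b p) s' t' s'' →
      Exec (.loop b p) s (b.cost + t + t' + 1) s''

end RealRAM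

/-! ### Encoding of inputs and outputs -/

namespace StochKnapsack

/-- All outcomes of all items, item after item. -/
def Instance.flat (I : Instance) : List Atom := I.items.flatten

/-- Position in `I.flat` of the first outcome of item `i`. -/
def Instance.offset (I : Instance) (i : ℕ) : ℕ := ((I.items.take i).map List.length).sum

/-- Initial memory: the number of items, the capacity and the accuracy in variables; the numbers of
outcomes of the items in one array; the sizes, probabilities and profits of all outcomes, item
after item, in three arrays; zeros elsewhere. -/
def Instance.encode (I : Instance) (ε : ℝ) : RealRAM.Store where
  nvar := fun x => if x = 0 then I.items.length else 0
  rvar := fun x => if x = 0 then I.capacity else if x = 1 then ε else 0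
  narr := fun a i => if a = 0 then (I.item i).length else 0
  rarr := fun a k =>
    match I.flat[k]? with
    | none => 0
    | some o =>
      if a = 0 then o.size else if a = 1 then o.prob else if a = 2 then o.profit else 0

/-- The canonical policy written in memory: the bound in a variable, one table with the decision
for each total discretized size (`0` to stop, `i + 1` to insert item `i`), and three tables with
the discretization of each outcome of each item. -/
def decodePolicy (I : Instance) (s : RealRAM.Store) : CanonicalPolicy where
  bound := s.nvar 1
  insert := fun x => if s.narr 1 x = 0 then none else some (s.narr 1 x - 1)
  lo := fun i j => s.narr 2 (I.offset i + j)
  hi := fun i j => s.narr 3 (I.offset i + j)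
  up := fun i j => s.rarr 3 (I.offset i + j)

end StochKnapsack

end

noncomputable section

namespace StochKnapsack

/-! ### Elementary facts about instances -/

/-! Every size is rounded at random to one of the two neighbouring multiples of a grid unit δ of
order `min ε 1 ^ 3 / (1 + C)`, keeping its mean. Let d be the total rounded size minus the capacity
actually used. The number of copies is unbounded, so errors cannot be summed copy by copy. But a
copy of size x = (l + u)δ adds only u(1 - u)δ² ≤ δx to the expected square of d, and it lowers the
remaining capacity c by x. Hence d² + δc does not increase in expectation (`rounding_drift`), and
its value divided by η² bounds the chance that |d| ever reaches η. Large and small items need no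
separate treatment.

This potential compares the original and the rounded problem, whose value function is V, in both
directions. An arbitrary policy can be simulated in the rounded problem if its bound exceeds C by η
+ δ; the coins are independent of the realized outcomes, so drift costs only a fraction of the
profit (`IsSolution.profitWithin_le`). Conversely, the optimal table is run on the original instance
with η + δ more capacity than its bound; its decisions do depend on the coins, so the loss is
additive, and at most V 0 per unit of drift probability because V is decreasing
(`IsSolution.le_zero`, `IsSolution.le_profitWithin`). With η = ε/4 each direction costs a factor 1 -
ε/2 (`IsSolution.opt_le`).

The rounded problem is solved exactly, from large totals to small ones. A copy of rounded size zero
returns to the same state; this loop is eliminated by dividing by the probability of moving. If that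
probability is zero, the item has size zero almost surely, and if it has positive expected profit,
inserting it forever earns an infinite amount (`expectedProfit_eq_top`).

The bound L is cubic in (1 + C)(1 + 1/ε). Each outcome is rounded by counting up to at most L + 1,
and each of the L + 1 states scans all outcomes once, so the time is linear in the input size. The
program is verified in a weakest-precondition calculus that carries the step count. -/

theorem Instance.outcome_mem {I : Instance} {i j : ℕ} (hj : j < (I.item i).length) :
    I.item i ∈ I.items ∧ I.outcome i j ∈ I.item i := by
  have hi : i < I.items.length := by
    by_contra h
    simp [Instance.item, List.getD, not_lt.1 h] at hj
  refine ⟨?_, ?_⟩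
  · simp [Instance.item, List.getD, hi]
  · simp [Instance.outcome, List.getD, hj]

namespace Instance.Valid

variable {I : Instance} (hI : I.Valid) {i j : ℕ}
include hI

theorem outcome_size (hj : j < (I.item i).length) : 0 ≤ (I.outcome i j).size :=
  hI.size_nonneg _ (outcome_mem hj).1 _ (outcome_mem hj).2

theorem outcome_prob (hj : j < (I.item i).length) : 0 ≤ (I.outcome i j).prob :=
  hI.prob_nonneg _ (outcome_mem hj).1 _ (outcome_mem hj).2

theorem outcome_profit (hj : j < (I.item i).length) : 0 ≤ (I.outcome i j).profit :=
  hI.profit_nonneg _ (outcome_mem hj).1 _ (outcome_mem hj).2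

theorem sum_prob (hi : i < I.items.length) :
    ∑ j ∈ Finset.range (I.item i).length, (I.outcome i j).prob = 1 := by
  have hm : I.item i ∈ I.items := by simp [Instance.item, List.getD, hi]
  rw [← hI.prob_sum _ hm, Finset.sum_range, ← Fin.sum_univ_getElem]
  simp only [Instance.outcome]
  have hl : ((I.item i).map Atom.prob).length = (I.item i).length := by simp
  refine Fintype.sum_equiv (finCongr hl.symm) _ _ fun x => ?_
  simp [List.getD]

end Instance.Valid

theorem profitWithin_nonneg {I : Instance} (hI : I.Valid) (σ : Policy) (k : ℕ) :
    ∀ h c, 0 ≤ profitWithin I σ k h c := by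
  induction k with
  | zero => intro h c; simp [profitWithin]
  | succ k ih =>
    intro h c
    rw [profitWithin]
    split
    · exact le_rfl
    · refine Finset.sum_nonneg fun j hj => ?_
      have hj := Finset.mem_range.1 hj
      split_ifs
      · exact mul_nonneg (hI.outcome_prob hj) (add_nonneg (hI.outcome_profit hj) (ih _ _))
      · exact le_rfl

theorem CanonicalPolicy.profitWithin_nonneg {I : Instance} (hI : I.Valid) {ρ : CanonicalPolicy}
    (hρ : ρ.WellFormed I) (k : ℕ) : ∀ s c, 0 ≤ ρ.profitWithin I k s c := by
  induction k with
  | zero => intro h c; simp [CanonicalPolicy.profitWithin]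
  | succ k ih =>
    intro s c
    rw [CanonicalPolicy.profitWithin]
    split_ifs
    · exact le_rfl
    split
    · exact le_rfl
    · refine Finset.sum_nonneg fun j hj => ?_
      have hj := Finset.mem_range.1 hj
      split_ifs
      · have h1 := hρ _ _ hj
        exact mul_nonneg (hI.outcome_prob hj) (add_nonneg (hI.outcome_profit hj)
          (add_nonneg (mul_nonneg (by linarith) (ih _ _)) (mul_nonneg h1.1 (ih _ _))))
      · exact le_rfl

/-! ### Randomized rounding of sizes and the dynamic program -/

/-- The size of an outcome is rounded at random to one of the two neighbouring multiples of `δ`,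
without changing the mean; sizes beyond the bound `L` need not be represented exactly. -/
structure IsRounding (I : Instance) (L : ℕ) (δ : ℝ) (lo : ℕ → ℕ → ℕ) (up : ℕ → ℕ → ℝ) :
    Prop where
  up_nonneg : ∀ i j, j < (I.item i).length → 0 ≤ up i j
  up_le_one : ∀ i j, j < (I.item i).length → up i j ≤ 1
  size_eq : ∀ i j, j < (I.item i).length → lo i j ≤ L →
    (I.outcome i j).size = (lo i j + up i j) * δ
  size_ge : ∀ i j, j < (I.item i).length → L < lo i j → (L + 1) * δ ≤ (I.outcome i j).size

/-- Probability that a copy of item `i` has nonzero rounded size. -/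
def moveProb (I : Instance) (lo : ℕ → ℕ → ℕ) (up : ℕ → ℕ → ℝ) (i : ℕ) : ℝ :=
  ∑ j ∈ Finset.range (I.item i).length,
    (I.outcome i j).prob * (if lo i j = 0 then up i j else 1)

/-- Profit `r` plus the value of the total rounded size `s'`, nothing on overflow. -/
def reward (L : ℕ) (V : ℕ → ℝ) (r : ℝ) (s' : ℕ) : ℝ := if s' ≤ L then r + V s' else 0

/-- Expected reward of one copy of item `i` inserted at total rounded size `s`. -/
def backup (I : Instance) (L : ℕ) (lo : ℕ → ℕ → ℕ) (up : ℕ → ℕ → ℝ) (V : ℕ → ℝ) (s i : ℕ) : ℝ :=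
  ∑ j ∈ Finset.range (I.item i).length,
    (I.outcome i j).prob *
      ((1 - up i j) * reward L V (I.outcome i j).profit (s + lo i j) +
        up i j * reward L V (I.outcome i j).profit (s + (lo i j + 1)))

/-- As `backup`, but without the value of the current state. -/
def properBackup (I : Instance) (L : ℕ) (lo : ℕ → ℕ → ℕ) (up : ℕ → ℕ → ℝ) (V : ℕ → ℝ)
    (s i : ℕ) : ℝ :=
  backup I L lo up (Function.update V s 0) s i

/-- `V` solves the optimality equations of the rounded problem, and `act` attains the maxima. -/
structure IsSolution (I : Instance) (L : ℕ) (lo : ℕ → ℕ → ℕ) (up : ℕ → ℕ → ℝ) (V : ℕ → ℝ)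
    (act : ℕ → Option ℕ) : Prop where
  nonneg : ∀ s, 0 ≤ V s
  eq_zero : ∀ s, L < s → V s = 0
  le : ∀ s i, s ≤ L → i < I.items.length →
    properBackup I L lo up V s i ≤ moveProb I lo up i * V s
  none : ∀ s, s ≤ L → act s = none → V s = 0
  some : ∀ s i, s ≤ L → act s = some i → i < I.items.length ∧ 0 < moveProb I lo up i ∧
    properBackup I L lo up V s i = moveProb I lo up i * V s

/-! ### The optimality equations and the monotonicity of the value -/

variable {I : Instance} {L : ℕ} {δ : ℝ} {lo : ℕ → ℕ → ℕ} {up : ℕ → ℕ → ℝ} {V : ℕ → ℝ}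
  {act : ℕ → Option ℕ}

/-- The proper backup looks only at totals above the current one, so the equations can be solved
from the bound downwards. -/
theorem properBackup_congr {V' : ℕ → ℝ} {s : ℕ} (h : ∀ s', s < s' → s' ≤ L → V s' = V' s')
    (i : ℕ) : properBackup I L lo up V s i = properBackup I L lo up V' s i := by
  have key : ∀ r s', s ≤ s' →
      reward L (Function.update V s 0) r s' = reward L (Function.update V' s 0) r s' := by
    intro r s' hs
    unfold reward
    split_ifs with h1
    · rcases hs.eq_or_lt with rfl | h2
      · simp
      · simp [Function.update_of_ne h2.ne', h s' h2 h1]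
    · rfl
  unfold properBackup backup
  refine Finset.sum_congr rfl fun j _ => ?_
  rw [key _ _ (by omega), key _ _ (by omega)]

/-- Isolates the self-loop: with probability `1 - moveProb` the rounded total stays at `s` and the
value `V s` is collected again. The fixed-point equation thereby becomes linear in `V s`. -/
theorem backup_eq (hI : I.Valid) {s i : ℕ} (hs : s ≤ L) (hi : i < I.items.length) :
    backup I L lo up V s i =
      properBackup I L lo up V s i + (1 - moveProb I lo up i) * V s := by
  rw [← hI.sum_prob hi, moveProb, properBackup, ← Finset.sum_sub_distrib, Finset.sum_mul, backup,
    backup, ← Finset.sum_add_distrib]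
  refine Finset.sum_congr rfl fun j _ => ?_
  have h1 : ∀ r, reward L (Function.update V s 0) r (s + (lo i j + 1)) =
      reward L V r (s + (lo i j + 1)) := by
    intro r; unfold reward; rw [Function.update_of_ne (by omega)]
  rw [h1]
  by_cases h0 : lo i j = 0
  · simp only [h0, reward]
    simp [hs]
    ring
  · have h2 : ∀ r, reward L (Function.update V s 0) r (s + lo i j) =
        reward L V r (s + lo i j) := by
      intro r; unfold reward; rw [Function.update_of_ne (by omega)]
    rw [h2, if_neg h0]
    ring

theorem IsSolution.backup_le (hV : IsSolution I L lo up V act) (hI : I.Valid) {s i : ℕ}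
    (hs : s ≤ L) (hi : i < I.items.length) : backup I L lo up V s i ≤ V s := by
  rw [backup_eq hI hs hi]
  linarith [hV.le s i hs hi]

theorem IsSolution.backup_act (hV : IsSolution I L lo up V act) (hI : I.Valid) {s i : ℕ}
    (hs : s ≤ L) (hi : act s = Option.some i) : backup I L lo up V s i = V s := by
  obtain ⟨h1, -, h2⟩ := hV.some s i hs hi
  rw [backup_eq hI hs h1]
  linarith

/-- The item chosen at `s + 1` is also available at `s`, where it leaves more room; its probability
of moving is the same in both states and cancels. The induction on `n` runs downwards in `s`. -/
theorem IsSolution.succ_le (hV : IsSolution I L lo up V act) (hI : I.Valid)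
    (hR : IsRounding I L δ lo up) (n : ℕ) : ∀ s, L ≤ s + n → V (s + 1) ≤ V s := by
  induction n with
  | zero => intro s hs; rw [hV.eq_zero (s + 1) (by omega)]; exact hV.nonneg s
  | succ n ih =>
    intro s hs
    by_cases hL : L < s + 1
    · rw [hV.eq_zero (s + 1) hL]; exact hV.nonneg s
    have hL := not_lt.1 hL
    rcases ha : act (s + 1) with _ | i
    · rw [hV.none _ hL ha]; exact hV.nonneg s
    obtain ⟨hi, hm, he⟩ := hV.some _ _ hL ha
    have hle := hV.le s i (by omega) hi
    refine le_of_mul_le_mul_left ?_ hm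
    rw [← he]
    refine le_trans ?_ hle
    have key : ∀ r s', 0 ≤ r → s ≤ s' → reward L (Function.update V (s + 1) 0) r (s' + 1) ≤
        reward L (Function.update V s 0) r s' := by
      intro r s' hr hss
      unfold reward
      -- A copy of rounded size zero leads back to the current state, whose value is set to zero on
      -- both sides.
      rcases hss.eq_or_lt with rfl | h2
      · rw [if_pos hL, if_pos (by omega)]; simp
      · rw [Function.update_of_ne (by omega), Function.update_of_ne (by omega)]
        have h3 := ih s' (by omega)
        split_ifs
        · linarith
        · omega
        · linarith [hV.nonneg s']
        · exact le_rfl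
    unfold properBackup backup
    refine Finset.sum_le_sum fun j hj => ?_
    have hj := Finset.mem_range.1 hj
    have hp := hI.outcome_profit hj
    have h1 := key _ (s + lo i j) hp (by omega)
    have h2 := key _ (s + (lo i j + 1)) hp (by omega)
    rw [show s + 1 + lo i j = s + lo i j + 1 by ring,
      show s + 1 + (lo i j + 1) = s + (lo i j + 1) + 1 by ring]
    refine mul_le_mul_of_nonneg_left (add_le_add ?_ ?_) (hI.outcome_prob hj)
    · exact mul_le_mul_of_nonneg_left h1 (by linarith [hR.up_le_one i j hj])
    · exact mul_le_mul_of_nonneg_left h2 (hR.up_nonneg i j hj)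

theorem IsSolution.le_zero (hV : IsSolution I L lo up V act) (hI : I.Valid)
    (hR : IsRounding I L δ lo up) (s : ℕ) : V s ≤ V 0 :=
  antitone_nat_of_succ_le (fun s => hV.succ_le hI hR L s (by omega)) (Nat.zero_le s)

/-! ### The drift potential and the comparison of the two problems -/

/-- Rounding a size at random adds less to the expected squared drift than is paid for by the
capacity the copy uses. -/
theorem rounding_drift {l u δ c d η x : ℝ} (hx : x = (l + u) * δ) (hl : 0 ≤ l) :
    (1 - u) * (((d + l * δ - x) ^ 2 + δ * (c - x)) / η ^ 2) +
      u * (((d + (l + 1) * δ - x) ^ 2 + δ * (c - x)) / η ^ 2) ≤ (d ^ 2 + δ * c) / η ^ 2 := by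
  rw [← mul_div_assoc, ← mul_div_assoc, ← add_div]
  refine div_le_div_of_nonneg_right ?_ (sq_nonneg η)
  have : (1 - u) * ((d + l * δ - x) ^ 2 + δ * (c - x)) +
      u * ((d + (l + 1) * δ - x) ^ 2 + δ * (c - x)) = d ^ 2 + δ * c - δ ^ 2 * (l + u ^ 2) := by
    subst hx; ring
  rw [this]
  have : 0 ≤ δ ^ 2 * (l + u ^ 2) := by positivity
  linarith

theorem sum_prob_mul_sub {ι : Type*} (t : Finset ι) (p f z : ι → ℝ) (hp : ∑ j ∈ t, p j = 1)
    (A B : ℝ) :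
    ∑ j ∈ t, p j * (f j - A - B * (1 - z j / 2)) =
      ∑ j ∈ t, p j * f j - A - B * (1 - (∑ j ∈ t, p j * z j) / 2) := by
  have : ∀ j, p j * (f j - A - B * (1 - z j / 2)) =
      p j * f j - p j * (A + B) + p j * z j * (B / 2) := fun j => by ring
  simp only [this, Finset.sum_add_distrib, Finset.sum_sub_distrib, ← Finset.sum_mul, hp]
  ring

/-- A move at least halves the weight `(1 / 2) ^ s`. The weight thus shrinks geometrically in
expectation, which controls how long the table can keep inserting although single copies may leave
`s` unchanged. -/
theorem half_pow_average {u : ℝ} (hu0 : 0 ≤ u) (s l : ℕ) :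
    (1 - u) * (1 / 2 : ℝ) ^ (s + l) + u * (1 / 2) ^ (s + (l + 1)) ≤
      (1 / 2) ^ s * (1 - (if l = 0 then u else 1) / 2) := by
  have : (1 - u) * (1 / 2 : ℝ) ^ (s + l) + u * (1 / 2) ^ (s + (l + 1)) =
      (1 / 2) ^ s * ((1 - u / 2) * (1 / 2) ^ l) := by
    rw [pow_add, pow_add, pow_succ]; ring
  rw [this]
  refine mul_le_mul_of_nonneg_left ?_ (by positivity)
  split_ifs with h0
  · simp [h0]
  · obtain ⟨m, rfl⟩ := Nat.exists_eq_succ_of_ne_zero h0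
    have h2 : (1 / 2 : ℝ) ^ (m + 1) ≤ 1 / 2 := by
      rw [pow_succ]
      have : (1 / 2 : ℝ) ^ m ≤ 1 := pow_le_one₀ (by norm_num) (by norm_num)
      linarith
    have h3 : (0 : ℝ) ≤ (1 / 2) ^ (m + 1) := by positivity
    change (1 - u / 2) * (1 / 2) ^ (m + 1) ≤ _
    nlinarith

/-- The rounded problem is at least as profitable as any policy, up to a factor that accounts
for the event that the rounded total size drifts away from the actual one by more than `η`. -/
theorem IsSolution.profitWithin_le (hV : IsSolution I L lo up V act) (hI : I.Valid)
    (hR : IsRounding I L δ lo up) (hδ : 0 < δ) {η : ℝ} (hη : 0 < η)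
    (hL : I.capacity + η + δ ≤ L * δ) (σ : Policy) (k : ℕ) :
    ∀ (h : List (ℕ × ℕ)) (c : ℝ) (s : ℕ), 0 ≤ c →
      profitWithin I σ k h c * (1 - ((s * δ - (I.capacity - c)) ^ 2 + δ * c) / η ^ 2) ≤ V s := by
  induction k with
  | zero => intro h c s _; simpa [profitWithin] using hV.nonneg s
  | succ k ih =>
    intro h c s hc
    set φ : ℝ → ℝ → ℝ := fun d c => 1 - (d ^ 2 + δ * c) / η ^ 2 with hφ
    change _ * φ (s * δ - (I.capacity - c)) c ≤ _
    set d := s * δ - (I.capacity - c) with hd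
    have hη2 : 0 < η ^ 2 := by positivity
    -- Once the potential reaches one the left side is not positive. Otherwise |d| < η, and the
    -- rounded total is still within the bound.
    rcases le_or_gt (φ d c) 0 with h0 | h0
    · exact (mul_nonpos_of_nonneg_of_nonpos (profitWithin_nonneg hI _ _ _ _) h0).trans
        (hV.nonneg s)
    have hφ1 : φ d c ≤ 1 := by
      have : 0 ≤ (d ^ 2 + δ * c) / η ^ 2 := by positivity
      simp only [hφ]; linarith
    have hdη : d < η := by
      have h1 : (d ^ 2 + δ * c) / η ^ 2 < 1 := by simp only [hφ] at h0; linarith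
      rw [div_lt_one hη2] at h1
      have h2 : d ^ 2 < η ^ 2 := by nlinarith
      exact lt_of_pow_lt_pow_left₀ 2 hη.le h2
    have hsL : s ≤ L := by
      by_contra hcon
      have : ((L : ℝ) + 1) ≤ s := by exact_mod_cast not_le.1 hcon
      nlinarith
    rw [profitWithin]
    split
    · simpa using hV.nonneg s
    rename_i i _
    -- An index beyond the list names the empty item, which earns nothing.
    by_cases hi : i < I.items.length
    swap
    · have : I.item i = [] := by simp [Instance.item, List.getD, not_lt.1 hi]
      simpa [this] using hV.nonneg s
    refine le_trans ?_ (hV.backup_le hI hsL hi)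
    rw [Finset.sum_mul, backup]
    refine Finset.sum_le_sum fun j hj => ?_
    have hj := Finset.mem_range.1 hj
    have hu0 := hR.up_nonneg i j hj
    have hu1 := hR.up_le_one i j hj
    have hp := hI.outcome_prob hj
    have hr := hI.outcome_profit hj
    have hx := hI.outcome_size hj
    have hrew : ∀ s', 0 ≤ reward L V (I.outcome i j).profit s' := by
      intro s'; unfold reward; split_ifs
      · linarith [hV.nonneg s']
      · exact le_rfl
    split_ifs with hxc
    swap
    · rw [zero_mul]
      exact mul_nonneg hp (add_nonneg (mul_nonneg (by linarith) (hrew _))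
        (mul_nonneg hu0 (hrew _)))
    set x := (I.outcome i j).size with hxdef
    set W := profitWithin I σ k ((i, j) :: h) (c - x) with hW
    have hW0 : 0 ≤ W := profitWithin_nonneg hI _ _ _ _
    have hs0 : (0 : ℝ) ≤ s * δ := by positivity
    have hlo : lo i j ≤ L := by
      by_contra hcon
      have := hR.size_ge i j hj (not_le.1 hcon)
      rw [← hxdef] at this
      nlinarith
    have hxe := hR.size_eq i j hj hlo
    rw [← hxdef] at hxe
    set l := lo i j
    set u := up i j
    -- A copy that fits has x ≤ c, so even after rounding up the total is at most C + η + δ; the δ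
    -- in `hL` is reserved for this.
    have hhi : s + (l + 1) ≤ L := by
      have h1 : ((s + (l + 1) : ℕ) : ℝ) * δ ≤ L * δ := by
        push_cast
        have : 0 ≤ u * δ := by positivity
        nlinarith
      exact_mod_cast le_of_mul_le_mul_right h1 hδ
    have e1 := ih ((i, j) :: h) (c - x) (s + l) (by linarith)
    have e2 := ih ((i, j) :: h) (c - x) (s + (l + 1)) (by linarith)
    rw [← hW] at e1 e2
    have d1 : ((s + l : ℕ) : ℝ) * δ - (I.capacity - (c - x)) = d + l * δ - x := by
      push_cast; rw [hd]; ring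
    have d2 : ((s + (l + 1) : ℕ) : ℝ) * δ - (I.capacity - (c - x)) = d + (l + 1) * δ - x := by
      push_cast; rw [hd]; ring
    rw [d1] at e1
    rw [d2] at e2
    rw [reward, reward, if_pos (by omega), if_pos hhi, mul_assoc]
    refine mul_le_mul_of_nonneg_left ?_ hp
    have key : φ d c ≤ (1 - u) * (1 - ((d + l * δ - x) ^ 2 + δ * (c - x)) / η ^ 2) +
        u * (1 - ((d + (l + 1) * δ - x) ^ 2 + δ * (c - x)) / η ^ 2) := by
      have := rounding_drift (c := c) (d := d) (η := η) hxe (Nat.cast_nonneg l)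
      simp only [hφ]
      linarith
    have k1 := mul_le_mul_of_nonneg_left e1 (by linarith : (0 : ℝ) ≤ 1 - u)
    have k2 := mul_le_mul_of_nonneg_left e2 hu0
    have k3 := mul_le_mul_of_nonneg_left key hW0
    -- The profit of the present copy is merely scaled by a factor of at most one.
    have k4 := mul_le_mul_of_nonneg_left hφ1 hr
    nlinarith

/-- Run on the original instance, the optimal table earns almost the optimal value of the rounded
problem.  The last term bounds what is earned after the first `k` insertions. -/
theorem IsSolution.le_profitWithin {ρ : CanonicalPolicy}
    (hV : IsSolution I ρ.bound ρ.lo ρ.up V ρ.insert) (hI : I.Valid)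
    (hR : IsRounding I ρ.bound δ ρ.lo ρ.up)
    (hhi : ∀ i j, j < (I.item i).length → ρ.hi i j = ρ.lo i j + 1)
    (hδ : 0 < δ) {η C β : ℝ} (hη : 0 < η) (hL : ρ.bound * δ + η + δ ≤ C) (hβ0 : 0 ≤ β)
    (hβ : ∀ s i, s ≤ ρ.bound → ρ.insert s = Option.some i → 1 - moveProb I ρ.lo ρ.up i / 2 ≤ β)
    (k : ℕ) :
    ∀ (c : ℝ) (s : ℕ), 0 ≤ c →
      V s - V 0 * (((s * δ - (C - c)) ^ 2 + δ * c) / η ^ 2)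
        - V 0 * 2 ^ ρ.bound * β ^ k * (1 / 2) ^ s ≤ ρ.profitWithin I k s c := by
  have hwf : ρ.WellFormed I := fun i j hj => ⟨hR.up_nonneg i j hj, hR.up_le_one i j hj⟩
  have hV0 := hV.nonneg 0
  have hη2 : 0 < η ^ 2 := by positivity
  induction k with
  | zero =>
    intro c s hc
    have hψ : 0 ≤ V 0 * (((s * δ - (C - c)) ^ 2 + δ * c) / η ^ 2) := by positivity
    rw [CanonicalPolicy.profitWithin, pow_zero, mul_one]
    rcases le_or_gt s ρ.bound with hs | hs
    -- The factor `2 ^ ρ.bound` makes the truncation term at least `V 0` in every state within the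
    -- bound.
    · have h1 : (1 : ℝ) ≤ 2 ^ ρ.bound * (1 / 2) ^ s := by
        obtain ⟨m, hm⟩ := Nat.exists_eq_add_of_le hs
        rw [hm, pow_add, mul_right_comm, ← mul_pow]
        norm_num
        exact one_le_pow₀ (by norm_num)
      have h2 := mul_le_mul_of_nonneg_left h1 hV0
      linarith [hV.le_zero hI hR s]
    · rw [hV.eq_zero s hs]
      have : 0 ≤ V 0 * 2 ^ ρ.bound * (1 / 2) ^ s := by positivity
      linarith
  | succ k ih =>
    intro c s hc
    set ψ : ℝ → ℝ → ℝ := fun d c => (d ^ 2 + δ * c) / η ^ 2 with hψ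
    change V s - V 0 * ψ (s * δ - (C - c)) c - _ ≤ _
    set d := s * δ - (C - c) with hd
    have hψ0 : ∀ d c, 0 ≤ c → 0 ≤ ψ d c := fun d c hc => by simp only [hψ]; positivity
    have hψ' := mul_nonneg hV0 (hψ0 d c hc)
    have hT : ∀ k s : ℕ, 0 ≤ V 0 * 2 ^ ρ.bound * β ^ k * (1 / 2) ^ s := fun k s => by positivity
    have hT' := hT (k + 1) s
    have hnn := CanonicalPolicy.profitWithin_nonneg hI hwf
    -- If the potential is at least one, the loss term already exceeds `V s ≤ V 0`.
    rcases le_or_gt 1 (ψ d c) with h1 | h1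
    · have := mul_le_mul_of_nonneg_left h1 hV0
      linarith [hnn (k + 1) s c, hV.le_zero hI hR s]
    have hdη : -η < d := by
      simp only [hψ] at h1
      rw [div_lt_one hη2] at h1
      have h2 : d ^ 2 < η ^ 2 := by nlinarith
      exact (abs_lt_of_sq_lt_sq' h2 hη.le).1
    rcases lt_or_ge ρ.bound s with hs | hs
    · rw [hV.eq_zero s hs]
      linarith [hnn (k + 1) s c]
    rw [CanonicalPolicy.profitWithin, if_neg (not_lt.2 hs)]
    split
    · rename_i ha
      rw [hV.none s hs ha]; linarith
    rename_i i ha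
    obtain ⟨hi, hm, -⟩ := hV.some s i hs ha
    -- As the probabilities sum to one, the error terms can be spread over the outcomes, which are
    -- then compared one by one.
    have hsum : ∑ j ∈ Finset.range (I.item i).length, (I.outcome i j).prob *
          ((1 - ρ.up i j) * reward ρ.bound V (I.outcome i j).profit (s + ρ.lo i j) +
            ρ.up i j * reward ρ.bound V (I.outcome i j).profit (s + (ρ.lo i j + 1))
          - V 0 * ψ d c
          - V 0 * 2 ^ ρ.bound * β ^ k * (1 / 2) ^ s
            * (1 - (if ρ.lo i j = 0 then ρ.up i j else 1) / 2)) =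
        V s - V 0 * ψ d c - V 0 * 2 ^ ρ.bound * β ^ k * (1 / 2) ^ s
            * (1 - moveProb I ρ.lo ρ.up i / 2) := by
      rw [sum_prob_mul_sub _ _ _ _ (hI.sum_prob hi)]
      rw [← hV.backup_act hI hs ha, moveProb, backup]
    have hfin : V s - V 0 * ψ d c - V 0 * 2 ^ ρ.bound * β ^ (k + 1) * (1 / 2) ^ s ≤
        V s - V 0 * ψ d c - V 0 * 2 ^ ρ.bound * β ^ k * (1 / 2) ^ s
            * (1 - moveProb I ρ.lo ρ.up i / 2) := by
      have := mul_le_mul_of_nonneg_left (hβ s i hs ha) (hT k s)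
      rw [pow_succ]
      linarith
    refine hfin.trans (hsum.symm.le.trans (Finset.sum_le_sum fun j hj => ?_))
    have hj := Finset.mem_range.1 hj
    have hu0 := hR.up_nonneg i j hj
    have hu1 := hR.up_le_one i j hj
    have hp := hI.outcome_prob hj
    have hr := hI.outcome_profit hj
    have hx := hI.outcome_size hj
    rw [hhi i j hj]
    set x := (I.outcome i j).size with hxdef
    set l := ρ.lo i j
    set u := ρ.up i j
    set r := (I.outcome i j).profit
    have hz : 0 ≤ 1 - (if l = 0 then u else 1) / 2 := by split_ifs <;> linarith
    have hTz := mul_nonneg (hT k s) hz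
    have hs0 : (0 : ℝ) ≤ s * δ := by positivity
    by_cases hcase : x ≤ c ∧ l ≤ ρ.bound
    swap
    -- Actual overflow forces rounded overflow: if s + l were within the bound L, then d > -η and x
    -- ≤ (l + 1)δ would keep the capacity used below Lδ + η + δ ≤ C. The rounded problem therefore
    -- earns nothing here either.
    · have hover : ρ.bound < s + l := by
        by_contra hcon
        have hl : l ≤ ρ.bound := by omega
        have hxc : c < x := by
          by_contra h; exact hcase ⟨not_lt.1 h, hl⟩
        have hxe := hR.size_eq i j hj hl
        rw [← hxdef] at hxe
        have h3 : ((s + l : ℕ) : ℝ) ≤ ρ.bound := by exact_mod_cast not_lt.1 hcon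
        push_cast at h3
        have h4 : u * δ ≤ δ := by nlinarith
        have h5 := mul_le_mul_of_nonneg_right h3 hδ.le
        change x = (l + u) * δ at hxe
        nlinarith
      rw [reward, reward, if_neg (by omega), if_neg (by omega)]
      have hL0 : (I.outcome i j).prob * ((1 - u) * 0 + u * 0 - V 0 * ψ d c
          - V 0 * 2 ^ ρ.bound * β ^ k * (1 / 2) ^ s * (1 - (if l = 0 then u else 1) / 2)) ≤ 0 :=
        mul_nonpos_of_nonneg_of_nonpos hp (by linarith)
      refine hL0.trans ?_
      split_ifs
      · exact mul_nonneg hp (add_nonneg hr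
          (add_nonneg (mul_nonneg (by linarith) (hnn _ _ _)) (mul_nonneg hu0 (hnn _ _ _))))
      · exact le_rfl
    obtain ⟨hxc, hl⟩ := hcase
    rw [if_pos hxc]
    refine mul_le_mul_of_nonneg_left ?_ hp
    have hxe : x = (l + u) * δ := hR.size_eq i j hj hl
    have step : ∀ m : ℕ, reward ρ.bound V r (s + m)
        - V 0 * ψ (d + m * δ - x) (c - x) - V 0 * 2 ^ ρ.bound * β ^ k * (1 / 2) ^ (s + m) ≤
        r + ρ.profitWithin I k (s + m) (c - x) := by
      intro m
      have e0 := hψ0 (d + m * δ - x) (c - x) (by linarith)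
      have e1 := mul_nonneg hV0 e0
      have e2 := hT k (s + m)
      unfold reward
      split_ifs
      · have := ih (c - x) (s + m) (by linarith)
        have e3 : ((s + m : ℕ) : ℝ) * δ - (C - (c - x)) = d + m * δ - x := by
          push_cast; rw [hd]; ring
        rw [e3] at this
        change _ - V 0 * ψ _ _ - _ ≤ _ at this
        linarith
      · linarith [hnn k (s + m) (c - x)]
    have k1 := mul_le_mul_of_nonneg_left (step l) (by linarith : (0 : ℝ) ≤ 1 - u)
    have k2 := mul_le_mul_of_nonneg_left (step (l + 1)) hu0
    have key : (1 - u) * ψ (d + l * δ - x) (c - x) + u * ψ (d + (l + 1 : ℕ) * δ - x) (c - x) ≤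
        ψ d c := by
      rw [Nat.cast_succ]
      exact rounding_drift hxe (Nat.cast_nonneg l)
    have key2 := half_pow_average hu0 s l
    have k3 := mul_le_mul_of_nonneg_left key hV0
    have k4 := mul_le_mul_of_nonneg_left key2
      (by positivity : 0 ≤ V 0 * 2 ^ ρ.bound * β ^ k)
    nlinarith


/-! ### Free items and the approximation guarantee -/

theorem moveProb_nonneg (hI : I.Valid) (hR : IsRounding I L δ lo up) (i : ℕ) :
    0 ≤ moveProb I lo up i := by
  refine Finset.sum_nonneg fun j hj => ?_
  have hj := Finset.mem_range.1 hj
  refine mul_nonneg (hI.outcome_prob hj) ?_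
  split_ifs
  · exact hR.up_nonneg i j hj
  · exact zero_le_one

/-- If the rounded size of item `i` is always zero, then so is every size that occurs. -/
theorem rounded_eq_zero (hI : I.Valid) (hR : IsRounding I L δ lo up) {i : ℕ}
    (hm : moveProb I lo up i ≤ 0) {j : ℕ} (hj : j < (I.item i).length) :
    (I.outcome i j).prob = 0 ∨ lo i j = 0 ∧ up i j = 0 ∧ (I.outcome i j).size = 0 := by
  have h0 : moveProb I lo up i = 0 := le_antisymm hm (moveProb_nonneg hI hR i)
  rw [moveProb, Finset.sum_eq_zero_iff_of_nonneg] at h0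
  · have := h0 j (Finset.mem_range.2 hj)
    rcases mul_eq_zero.1 this with h | h
    · exact Or.inl h
    · right
      split_ifs at h with hl
      · refine ⟨hl, h, ?_⟩
        rw [hR.size_eq i j hj (by omega), hl, h]
        simp
      · exact absurd h one_ne_zero
  · intro j hj
    have hj := Finset.mem_range.1 hj
    refine mul_nonneg (hI.outcome_prob hj) ?_
    split_ifs
    · exact hR.up_nonneg i j hj
    · exact zero_le_one

/-- The right side depends on neither `s` nor `V`. A positive proper backup found at any state
therefore certifies a positive expected profit. -/
theorem properBackup_eq_of_moveProb (hI : I.Valid) (hR : IsRounding I L δ lo up) {s i : ℕ}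
    (hs : s ≤ L) (hm : moveProb I lo up i ≤ 0) :
    properBackup I L lo up V s i =
      ∑ j ∈ Finset.range (I.item i).length, (I.outcome i j).prob * (I.outcome i j).profit := by
  unfold properBackup backup
  refine Finset.sum_congr rfl fun j hj => ?_
  rcases rounded_eq_zero hI hR hm (Finset.mem_range.1 hj) with h | ⟨h1, h2, -⟩
  · simp [h]
  · simp [h1, h2, reward, hs]

/-- Inserting forever an item that takes no space and has positive expected profit. -/
theorem expectedProfit_eq_top {ρ : CanonicalPolicy} (hI : I.Valid)
    (hR : IsRounding I ρ.bound δ ρ.lo ρ.up) {s i : ℕ} (hi : i < I.items.length)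
    (hs : s ≤ ρ.bound) (hm : moveProb I ρ.lo ρ.up i ≤ 0)
    (hpos : 0 < properBackup I ρ.bound ρ.lo ρ.up V s i) (hact : ρ.insert 0 = some i) {c : ℝ}
    (hc : 0 ≤ c) : ρ.expectedProfit I c = ⊤ := by
  rw [properBackup_eq_of_moveProb hI hR hs hm] at hpos
  set r := ∑ j ∈ Finset.range (I.item i).length,
    (I.outcome i j).prob * (I.outcome i j).profit with hr
  have key : ∀ k : ℕ, ρ.profitWithin I k 0 c = k * r := by
    intro k
    induction k with
    | zero => simp [CanonicalPolicy.profitWithin]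
    | succ k ih =>
      rw [CanonicalPolicy.profitWithin, if_neg (by omega), hact]
      have : ((k + 1 : ℕ) : ℝ) * r = ∑ j ∈ Finset.range (I.item i).length,
          ((I.outcome i j).prob * (I.outcome i j).profit + (I.outcome i j).prob * (k * r)) := by
        rw [Finset.sum_add_distrib, ← Finset.sum_mul, hI.sum_prob hi, ← hr]
        push_cast; ring
      rw [this]
      refine Finset.sum_congr rfl fun j hj => ?_
      rcases rounded_eq_zero hI hR hm (Finset.mem_range.1 hj) with h | ⟨h1, h2, h3⟩
      · simp [h]
      · rw [h1, h2, h3, if_pos hc, sub_zero c, sub_zero (1 : ℝ), add_zero 0, ih]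
        ring
  refine ENNReal.eq_top_of_forall_nnreal_le fun b => ?_
  obtain ⟨k, hk⟩ := exists_nat_ge ((b : ℝ) / r)
  refine le_trans ?_ (le_iSup _ k)
  rw [key, ← ENNReal.ofReal_coe_nnreal]
  exact ENNReal.ofReal_le_ofReal ((div_le_iff₀ hpos).1 hk)

/-- Only finitely many states occur, and every chosen item moves with positive probability. -/
theorem IsSolution.exists_rate (hV : IsSolution I L lo up V act) :
    ∃ β : ℝ, 0 ≤ β ∧ β < 1 ∧
      ∀ s i, s ≤ L → act s = Option.some i → 1 - moveProb I lo up i / 2 ≤ β := by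
  obtain ⟨s₀, hs₀, hmax⟩ := Finset.exists_max_image (Finset.range (L + 1))
    (fun s => (act s).elim 0 fun i => 1 - moveProb I lo up i / 2) ⟨0, by simp⟩
  refine ⟨max 0 ((act s₀).elim 0 fun i => 1 - moveProb I lo up i / 2), le_max_left _ _, ?_, ?_⟩
  · refine max_lt one_pos ?_
    rcases h : act s₀ with _ | i
    · simp
    · have := (hV.some s₀ i (by simpa [Nat.lt_succ_iff] using hs₀) h).2.1
      simp only [Option.elim_some]
      linarith
  · intro s i hs hi
    have := hmax s (by simpa [Nat.lt_succ_iff] using hs)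
    rw [hi] at this
    exact le_max_of_le_right this

/-- The table that is optimal for the rounded problem is nearly optimal for the instance, with a
slightly larger capacity. -/
theorem IsSolution.opt_le {ρ : CanonicalPolicy}
    (hV : IsSolution I ρ.bound ρ.lo ρ.up V ρ.insert) (hI : I.Valid)
    (hR : IsRounding I ρ.bound δ ρ.lo ρ.up)
    (hhi : ∀ i j, j < (I.item i).length → ρ.hi i j = ρ.lo i j + 1)
    (hδ : 0 < δ) {ε : ℝ} (hε : 0 < ε) (hε1 : ε ≤ 1)
    (hL1 : I.capacity + ε / 4 + δ ≤ ρ.bound * δ)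
    (hL2 : ρ.bound * δ + ε / 4 + δ ≤ I.capacity + ε)
    (hδε : 32 * (δ * (I.capacity + ε)) ≤ ε ^ 3) :
    ENNReal.ofReal (1 - ε) * OPT I ≤ ρ.expectedProfit I (I.capacity + ε) := by
  have hC := hI.capacity_nonneg
  have hη : 0 < ε / 4 := by linarith
  have hV0 := hV.nonneg 0
  -- With η = ε/4 the initial potential is 16δ(C + ε)/ε², which `hδε` bounds by ε/2.
  have hfrac : δ * (I.capacity + ε) / (ε / 4) ^ 2 ≤ ε / 2 := by
    rw [div_le_iff₀ (by positivity)]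
    nlinarith
  have hlow : ENNReal.ofReal (V 0 * (1 - ε / 2)) ≤ ρ.expectedProfit I (I.capacity + ε) := by
    obtain ⟨β, hβ0, hβ1, hβ⟩ := hV.exists_rate
    -- The estimate holds for every horizon; the truncation term vanishes as `k` grows.
    have hk : ∀ k : ℕ, ENNReal.ofReal (V 0 * (1 - ε / 2) - V 0 * 2 ^ ρ.bound * β ^ k) ≤
        ρ.expectedProfit I (I.capacity + ε) := by
      intro k
      refine le_iSup_of_le k (ENNReal.ofReal_le_ofReal ?_)
      have := hV.le_profitWithin hI hR hhi hδ hη hL2 hβ0 hβ k (I.capacity + ε) 0 (by linarith)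
      simp only [Nat.cast_zero, zero_mul, sub_self, pow_zero, mul_one, zero_pow two_ne_zero,
        zero_add] at this
      have := mul_le_mul_of_nonneg_left hfrac hV0
      linarith
    refine le_of_tendsto' (x := Filter.atTop) (ENNReal.tendsto_ofReal ?_) hk
    have := (tendsto_pow_atTop_nhds_zero_of_lt_one hβ0 hβ1).const_mul (V 0 * 2 ^ ρ.bound)
    simpa using this.const_sub (V 0 * (1 - ε / 2))
  refine le_trans ?_ hlow
  rw [OPT, ENNReal.mul_iSup]
  refine iSup_le fun σ => ?_
  rw [expectedProfit, ENNReal.mul_iSup]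
  refine iSup_le fun k => ?_
  rw [← ENNReal.ofReal_mul (by linarith)]
  refine ENNReal.ofReal_le_ofReal ?_
  have h1 := hV.profitWithin_le hI hR hδ hη hL1 σ k [] I.capacity 0 hC
  have hW := profitWithin_nonneg hI σ k [] I.capacity
  simp only [Nat.cast_zero, zero_mul, sub_self, zero_pow two_ne_zero, zero_add] at h1
  have h2 : δ * I.capacity / (ε / 4) ^ 2 ≤ ε / 2 :=
    le_trans (by gcongr; linarith) hfrac
  have h3 := mul_le_mul_of_nonneg_left h2 hW
  set W := profitWithin I σ k [] I.capacity
  have h4 : W * (1 - ε / 2) ≤ V 0 := by linarith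
  have h5 := mul_le_mul_of_nonneg_right h4 (by linarith : 0 ≤ 1 - ε / 2)
  -- The two losses multiply: (1 - ε/2)² = 1 - ε + ε²/4.
  have h6 : 0 ≤ W * ε ^ 2 := by positivity
  linarith

end StochKnapsack

/-! ### Weakest preconditions for the real RAM -/

namespace RealRAM

/-- Started in `s`, the program halts with a running time and a final memory that satisfy `Q`. -/
def wp (p : Prog) (s : Store) (Q : ℕ → Store → Prop) : Prop := ∃ t s', Exec p s t s' ∧ Q t s'

/-- The natural variables that a program assigns to. -/
def Prog.nvars : Prog → List ℕ
  | .setN x _ => [x]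
  | .seq p q => p.nvars ++ q.nvars
  | .ite _ p q => p.nvars ++ q.nvars
  | .loop _ p => p.nvars
  | _ => []

/-- The real variables that a program assigns to. -/
def Prog.rvars : Prog → List ℕ
  | .setR x _ => [x]
  | .seq p q => p.rvars ++ q.rvars
  | .ite _ p q => p.rvars ++ q.rvars
  | .loop _ p => p.rvars
  | _ => []

/-- The natural arrays that a program writes to. -/
def Prog.narrs : Prog → List ℕ
  | .putN a _ _ => [a]
  | .seq p q => p.narrs ++ q.narrs
  | .ite _ p q => p.narrs ++ q.narrs
  | .loop _ p => p.narrs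
  | _ => []

/-- The real arrays that a program writes to. -/
def Prog.rarrs : Prog → List ℕ
  | .putR a _ _ => [a]
  | .seq p q => p.rarrs ++ q.rarrs
  | .ite _ p q => p.rarrs ++ q.rarrs
  | .loop _ p => p.rarrs
  | _ => []

/-- The memories `s` and `s'` agree on everything that `p` does not write to. -/
structure Unchanged (p : Prog) (s s' : Store) : Prop where
  nvar : ∀ x, x ∉ p.nvars → s'.nvar x = s.nvar x
  rvar : ∀ x, x ∉ p.rvars → s'.rvar x = s.rvar x
  narr : ∀ a, a ∉ p.narrs → s'.narr a = s.narr a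
  rarr : ∀ a, a ∉ p.rarrs → s'.rarr a = s.rarr a

theorem Unchanged.refl (p : Prog) (s : Store) : Unchanged p s s :=
  ⟨fun _ _ => rfl, fun _ _ => rfl, fun _ _ => rfl, fun _ _ => rfl⟩

theorem Unchanged.trans {p : Prog} {s₁ s₂ s₃ : Store} (h : Unchanged p s₁ s₂)
    (h' : Unchanged p s₂ s₃) : Unchanged p s₁ s₃ :=
  ⟨fun x hx => (h'.nvar x hx).trans (h.nvar x hx), fun x hx => (h'.rvar x hx).trans (h.rvar x hx),
    fun x hx => (h'.narr x hx).trans (h.narr x hx), fun x hx => (h'.rarr x hx).trans (h.rarr x hx)⟩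

theorem Unchanged.mono {p q : Prog} {s s' : Store} (h : Unchanged p s s')
    (hn : p.nvars ⊆ q.nvars) (hr : p.rvars ⊆ q.rvars) (hna : p.narrs ⊆ q.narrs)
    (hra : p.rarrs ⊆ q.rarrs) : Unchanged q s s' :=
  ⟨fun x hx => h.nvar x fun h => hx (hn h), fun x hx => h.rvar x fun h => hx (hr h),
    fun x hx => h.narr x fun h => hx (hna h), fun x hx => h.rarr x fun h => hx (hra h)⟩

/-- The frame rule. The written locations are computed from the syntax, so for a concrete program
its side conditions are settled by `decide`. -/
theorem Exec.unchanged {p : Prog} {s s' : Store} {t : ℕ} (h : Exec p s t s') :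
    Unchanged p s s' := by
  induction h with
  | setN x e s =>
    refine ⟨fun y hy => ?_, fun _ _ => rfl, fun _ _ => rfl, fun _ _ => rfl⟩
    exact Function.update_of_ne (by simpa [Prog.nvars] using hy) _ _
  | setR x e s =>
    refine ⟨fun _ _ => rfl, fun y hy => ?_, fun _ _ => rfl, fun _ _ => rfl⟩
    exact Function.update_of_ne (by simpa [Prog.rvars] using hy) _ _
  | putN a i e s =>
    refine ⟨fun _ _ => rfl, fun _ _ => rfl, fun y hy => ?_, fun _ _ => rfl⟩
    exact Function.update_of_ne (by simpa [Prog.narrs] using hy) _ _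
  | putR a i e s =>
    refine ⟨fun _ _ => rfl, fun _ _ => rfl, fun _ _ => rfl, fun y hy => ?_⟩
    exact Function.update_of_ne (by simpa [Prog.rarrs] using hy) _ _
  | seq _ _ h1 h2 =>
    exact (h1.mono (by simp [Prog.nvars]) (by simp [Prog.rvars]) (by simp [Prog.narrs])
      (by simp [Prog.rarrs])).trans (h2.mono (by simp [Prog.nvars]) (by simp [Prog.rvars])
      (by simp [Prog.narrs]) (by simp [Prog.rarrs]))
  | ite_true _ _ h =>
    exact h.mono (by simp [Prog.nvars]) (by simp [Prog.rvars]) (by simp [Prog.narrs])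
      (by simp [Prog.rarrs])
  | ite_false _ _ h =>
    exact h.mono (by simp [Prog.nvars]) (by simp [Prog.rvars]) (by simp [Prog.narrs])
      (by simp [Prog.rarrs])
  | loop_done _ => exact Unchanged.refl _ _
  | loop_step _ _ _ h1 h2 =>
    exact Unchanged.trans ⟨h1.nvar, h1.rvar, h1.narr, h1.rarr⟩ h2

theorem wp_mono {p : Prog} {s : Store} {Q Q' : ℕ → Store → Prop} (h : wp p s Q)
    (hQ : ∀ t s', Unchanged p s s' → Q t s' → Q' t s') : wp p s Q' := by
  obtain ⟨t, s', he, hq⟩ := h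
  exact ⟨t, s', he, hQ t s' he.unchanged hq⟩

theorem wp_setN {x : ℕ} {e : NExp} {s : Store} {Q : ℕ → Store → Prop}
    (h : Q (e.cost + 1) { s with nvar := Function.update s.nvar x (e.eval s) }) :
    wp (.setN x e) s Q := ⟨_, _, .setN x e s, h⟩

theorem wp_setR {x : ℕ} {e : RExp} {s : Store} {Q : ℕ → Store → Prop}
    (h : Q (e.cost + 1) { s with rvar := Function.update s.rvar x (e.eval s) }) :
    wp (.setR x e) s Q := ⟨_, _, .setR x e s, h⟩

theorem wp_putN {a : ℕ} {i e : NExp} {s : Store} {Q : ℕ → Store → Prop}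
    (h : Q (i.cost + e.cost + 1) { s with
      narr := Function.update s.narr a (Function.update (s.narr a) (i.eval s) (e.eval s)) }) :
    wp (.putN a i e) s Q := ⟨_, _, .putN a i e s, h⟩

theorem wp_putR {a : ℕ} {i : NExp} {e : RExp} {s : Store} {Q : ℕ → Store → Prop}
    (h : Q (i.cost + e.cost + 1) { s with
      rarr := Function.update s.rarr a (Function.update (s.rarr a) (i.eval s) (e.eval s)) }) :
    wp (.putR a i e) s Q := ⟨_, _, .putR a i e s, h⟩

theorem wp_seq {p q : Prog} {s : Store} {Q : ℕ → Store → Prop}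
    (h : wp p s fun t s' => wp q s' fun t' => Q (t + t')) : wp (.seq p q) s Q := by
  obtain ⟨t, s', h1, t', s'', h2, hq⟩ := h
  exact ⟨_, _, .seq h1 h2, hq⟩

theorem wp_ite {b : BExp} {p q : Prog} {s : Store} {Q : ℕ → Store → Prop}
    (h1 : b.Holds s → wp p s fun t => Q (b.cost + t + 1))
    (h2 : ¬ b.Holds s → wp q s fun t => Q (b.cost + t + 1)) : wp (.ite b p q) s Q := by
  by_cases hb : b.Holds s
  · obtain ⟨t, s', h, hq⟩ := h1 hb
    exact ⟨_, _, .ite_true hb h, hq⟩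
  · obtain ⟨t, s', h, hq⟩ := h2 hb
    exact ⟨_, _, .ite_false hb h, hq⟩

/-- A loop that makes `N` passes, the `i`-th in time `T i`. -/
theorem wp_loop {b : BExp} {p : Prog} {s : Store} (Inv : ℕ → Store → Prop) (N : ℕ) (T : ℕ → ℕ)
    (h0 : Inv 0 s)
    (hstep : ∀ i < N, ∀ s', Unchanged p s s' → Inv i s' →
      b.Holds s' ∧ wp p s' fun t s'' => t ≤ T i ∧ Inv (i + 1) s'')
    (hend : ∀ s', Unchanged p s s' → Inv N s' → ¬ b.Holds s') :
    wp (.loop b p) s fun t s' =>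
      t ≤ ∑ i ∈ Finset.range N, (T i + b.cost + 1) + (b.cost + 1) ∧ Inv N s' := by
  -- The time of the passes already made is added on the left, so that the induction over the
  -- remaining passes closes with a fixed right side.
  have key : ∀ k i s', k + i = N → Unchanged p s s' → Inv i s' →
      wp (.loop b p) s' fun t s'' =>
        t + ∑ i ∈ Finset.range i, (T i + b.cost + 1) ≤
          ∑ i ∈ Finset.range N, (T i + b.cost + 1) + (b.cost + 1) ∧ Inv N s'' := by
    intro k
    induction k with
    | zero =>
      intro i s' hk hu hi
      obtain rfl : i = N := by omega
      exact ⟨_, _, .loop_done (hend s' hu hi), by omega, hi⟩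
    | succ k ih =>
      intro i s' hk hu hi
      obtain ⟨hb, t, s'', he, ht, hi'⟩ := hstep i (by omega) s' hu hi
      obtain ⟨t', s₃, he', ht', hN⟩ := ih (i + 1) s'' (by omega) (hu.trans he.unchanged) hi'
      refine ⟨_, _, .loop_step hb he he', ?_, hN⟩
      rw [Finset.sum_range_succ] at ht'
      omega
  refine wp_mono (key N 0 s (by omega) (Unchanged.refl _ _) h0) fun t s' _ h => ?_
  simpa using h

end RealRAM

/-! ### The encoding of an instance -/

namespace StochKnapsack

theorem Instance.offset_succ (I : Instance) (i : ℕ) :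
    I.offset (i + 1) = I.offset i + (I.item i).length := by
  unfold offset item
  rw [List.take_add_one]
  rcases h : I.items[i]? with _ | b
  · simp [List.getD, h]
  · simp [List.getD, h]

theorem getElem?_flatten_sum_take {α : Type*} (l : List (List α)) (i j : ℕ)
    (hj : j < (l.getD i []).length) :
    l.flatten[((l.take i).map List.length).sum + j]? = (l.getD i [])[j]? := by
  induction l generalizing i with
  | nil => simp at hj
  | cons b l ih =>
    cases i with
    | zero =>
      simp only [List.getD_cons_zero] at hj
      simp [List.getElem?_append_left hj]
    | succ i =>
      simp only [List.getD_cons_succ] at hj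
      have := ih i hj
      simp only [List.getD_cons_succ, List.flatten_cons, List.take_succ_cons, List.map_cons,
        List.sum_cons]
      rw [List.getElem?_append_right (by omega), ← this]
      congr 1
      omega

theorem Instance.flat_getElem? (I : Instance) {i j : ℕ} (hj : j < (I.item i).length) :
    I.flat[I.offset i + j]? = some (I.outcome i j) := by
  unfold flat offset
  rw [getElem?_flatten_sum_take _ _ _ hj]
  change (I.item i)[j]? = _
  simp [outcome, List.getD, hj]

theorem Instance.offset_add_lt (I : Instance) {i j : ℕ} (hj : j < (I.item i).length) :
    I.offset i + j < I.offset I.items.length := by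
  have h := I.flat_getElem? hj
  have h2 : I.offset I.items.length = I.flat.length := by
    simp [offset, flat, List.length_flatten]
  rw [h2]
  exact (List.getElem?_eq_some_iff.1 h).1

theorem Instance.exists_of_lt_offset (I : Instance) {n k : ℕ} (hk : k < I.offset n) :
    ∃ i j, j < (I.item i).length ∧ k = I.offset i + j := by
  induction n with
  | zero => simp [offset] at hk
  | succ n ih =>
    rw [offset_succ] at hk
    by_cases h : k < I.offset n
    · exact ih h
    · exact ⟨n, k - I.offset n, by omega, by omega⟩

theorem Instance.length_le_inputSize (I : Instance) :
    I.items.length + I.offset I.items.length + 1 ≤ I.inputSize := by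
  have : ∀ l : List Item, l.length + (l.map List.length).sum ≤
      (l.map fun b => 1 + 3 * b.length).sum := by
    intro l
    induction l with
    | nil => simp
    | cons b l ih => simp only [List.length_cons, List.map_cons, List.sum_cons]; omega
  have := this I.items
  simp only [inputSize, offset, List.take_length]
  omega

/-- The memory `s` holds the items of `I` as `Instance.encode` places them. -/
structure HoldsItems (I : Instance) (s : RealRAM.Store) : Prop where
  num : s.nvar 0 = I.items.length
  length : ∀ i, s.narr 0 i = (I.item i).length
  size : ∀ i j, j < (I.item i).length → s.rarr 0 (I.offset i + j) = (I.outcome i j).size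
  prob : ∀ i j, j < (I.item i).length → s.rarr 1 (I.offset i + j) = (I.outcome i j).prob
  profit : ∀ i j, j < (I.item i).length → s.rarr 2 (I.offset i + j) = (I.outcome i j).profit

theorem holdsItems_encode (I : Instance) (ε : ℝ) : HoldsItems I (I.encode ε) := by
  refine ⟨rfl, fun _ => rfl, ?_, ?_, ?_⟩ <;> intro i j hj <;>
    simp [Instance.encode, I.flat_getElem? hj]

theorem HoldsItems.of_unchanged {I : Instance} {s s' : RealRAM.Store} {p : RealRAM.Prog}
    (h : HoldsItems I s) (hu : RealRAM.Unchanged p s s') (h1 : 0 ∉ p.nvars) (h2 : 0 ∉ p.narrs)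
    (h3 : 0 ∉ p.rarrs ∧ 1 ∉ p.rarrs ∧ 2 ∉ p.rarrs) : HoldsItems I s' := by
  refine ⟨?_, ?_, ?_, ?_, ?_⟩
  · rw [hu.nvar 0 h1]; exact h.num
  · rw [hu.narr 0 h2]; exact h.length
  · rw [hu.rarr 0 h3.1]; exact h.size
  · rw [hu.rarr 1 h3.2.1]; exact h.prob
  · rw [hu.rarr 2 h3.2.2]; exact h.profit


open RealRAM

/-! ### The grid -/

/-- Real variables `2`, `3`: the accuracy `e = min ε 1` and the grid unit `e ^ 3 / (32 (C + 1))`. -/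
def gridUnit : Prog :=
  .seq (.setR 2 (.var 1)) <|
  -- Assigning to variable `13`, which is never read, serves as the empty statement.
  .seq (.ite (.rlt (.ofNat (.lit 1)) (.var 1)) (.setR 2 (.ofNat (.lit 1))) (.setN 13 (.lit 0))) <|
  .setR 3 (.div (.mul (.var 2) (.mul (.var 2) (.var 2)))
    (.mul (.ofNat (.lit 32)) (.add (.var 0) (.ofNat (.lit 1)))))

theorem wp_gridUnit (s : Store) :
    wp gridUnit s fun t s' => t ≤ 30 ∧ s'.rvar 2 = min (s.rvar 1) 1 ∧
      s'.rvar 3 = min (s.rvar 1) 1 ^ 3 / (32 * (s.rvar 0 + 1)) := by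
  refine wp_seq (wp_setR (wp_seq (wp_ite (fun h => wp_setR (wp_setR ?_))
    fun h => wp_setN (wp_setR ?_))))
  · simp [BExp.Holds, RExp.eval, NExp.eval] at h
    simp [RExp.eval, NExp.eval, RExp.cost, NExp.cost, BExp.cost, h.le]
  · simp [BExp.Holds, RExp.eval, NExp.eval] at h
    simp [RExp.eval, NExp.eval, RExp.cost, NExp.cost, BExp.cost, h]
    ring

/-- Natural variable `1`: the least bound whose multiple of the unit exceeds `C + e / 4` by at
least one unit. -/
def gridBound : Prog :=
  .loop (.rlt (.mul (.ofNat (.var 1)) (.var 3))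
      (.add (.add (.var 0) (.div (.var 2) (.ofNat (.lit 4)))) (.var 3)))
    (.setN 1 (.add (.var 1) (.lit 1)))

theorem wp_gridBound (s : Store) (h1 : s.nvar 1 = 0) (hδ : 0 < s.rvar 3) :
    wp gridBound s fun t s' =>
      t ≤ 20 * (s'.nvar 1 + 1) ∧
      s'.nvar 1 = ⌈(s.rvar 0 + s.rvar 2 / 4 + s.rvar 3) / s.rvar 3⌉₊ := by
  set N := ⌈(s.rvar 0 + s.rvar 2 / 4 + s.rvar 3) / s.rvar 3⌉₊ with hN
  refine wp_mono (wp_loop (fun i s' => s'.nvar 1 = i) N (fun _ => 4) h1 ?_ ?_) ?_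
  · intro i hi s' hu h
    refine ⟨?_, wp_setN ?_⟩
    · have := (lt_div_iff₀ hδ).1 (Nat.lt_ceil.1 hi)
      simpa [BExp.Holds, RExp.eval, NExp.eval, h, hu.rvar _ (by decide : 0 ∉ _),
        hu.rvar _ (by decide : 2 ∉ _), hu.rvar _ (by decide : 3 ∉ _)] using this
    · simp [NExp.eval, NExp.cost, h]
  · intro s' hu h
    have := (div_le_iff₀ hδ).1 (Nat.le_ceil ((s.rvar 0 + s.rvar 2 / 4 + s.rvar 3) / s.rvar 3))
    simpa [BExp.Holds, RExp.eval, NExp.eval, h, hu.rvar _ (by decide : 0 ∉ _),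
        hu.rvar _ (by decide : 2 ∉ _), hu.rvar _ (by decide : 3 ∉ _)] using this
  · rintro t s' - ⟨ht, h⟩
    refine ⟨?_, h⟩
    simp [BExp.cost, RExp.cost, NExp.cost] at ht
    rw [h]
    omega

/-- Natural variable `2`: the total number of outcomes. -/
def countOutcomes : Prog :=
  .loop (.nlt (.var 7) (.var 0)) <|
    .seq (.setN 2 (.add (.var 2) (.get 0 (.var 7)))) (.setN 7 (.add (.var 7) (.lit 1)))

theorem wp_countOutcomes {I : Instance} {s : Store} (hs : HoldsItems I s) (h2 : s.nvar 2 = 0)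
    (h7 : s.nvar 7 = 0) :
    wp countOutcomes s fun t s' =>
      t ≤ 20 * (I.items.length + 1) ∧ s'.nvar 2 = I.offset I.items.length := by
  refine wp_mono (wp_loop (fun i s' => s'.nvar 7 = i ∧ s'.nvar 2 = I.offset i) I.items.length
    (fun _ => 9) ⟨h7, h2⟩ ?_ ?_) ?_
  · rintro i hi s' hu ⟨h, h'⟩
    refine ⟨?_, wp_seq (wp_setN (wp_setN ?_))⟩
    · simpa [BExp.Holds, NExp.eval, h, hu.nvar _ (by decide : 0 ∉ _), hs.num] using hi
    · simp [NExp.eval, NExp.cost, h, h', hu.narr _ (by decide : 0 ∉ _), hs.length, I.offset_succ]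
  · rintro s' hu ⟨h, -⟩
    simp [BExp.Holds, NExp.eval, h, hu.nvar _ (by decide : 0 ∉ _), hs.num]
  · rintro t s' - ⟨ht, -, h⟩
    refine ⟨?_, h⟩
    simp [BExp.cost, NExp.cost] at ht
    omega

/-! ### Rounding the sizes -/

/-- Natural variable `4`: the integer part of the size of outcome number `3` in units of the grid,
at most the bound plus one. -/
def floorSize : Prog :=
  .seq (.setN 4 (.lit 0)) <|
  .loop (.and (.nlt (.var 4) (.add (.var 1) (.lit 1)))
      (.not (.rlt (.get 0 (.var 3)) (.mul (.ofNat (.add (.var 4) (.lit 1))) (.var 3)))))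
    (.setN 4 (.add (.var 4) (.lit 1)))

/-- The floor is found by counting, as the machine cannot round. Stopping at the bound plus one
limits the time; larger sizes overflow the rounded knapsack in any case. -/
theorem wp_floorSize (s : Store) (hδ : 0 < s.rvar 3) (hx : 0 ≤ s.rarr 0 (s.nvar 3)) :
    wp floorSize s fun t s' =>
      t ≤ 40 * (s.nvar 1 + 1) ∧
      s'.nvar 4 = min (s.nvar 1 + 1) ⌊s.rarr 0 (s.nvar 3) / s.rvar 3⌋₊ := by
  set N := min (s.nvar 1 + 1) ⌊s.rarr 0 (s.nvar 3) / s.rvar 3⌋₊ with hN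
  have hq : 0 ≤ s.rarr 0 (s.nvar 3) / s.rvar 3 := by positivity
  refine wp_seq (wp_setN (wp_mono (wp_loop (fun i s' => s'.nvar 4 = i) N (fun _ => 4)
    (by simp [NExp.eval]) ?_ ?_) ?_))
  · intro i hi s' hu h
    refine ⟨?_, wp_setN ?_⟩
    · obtain ⟨h1, h2⟩ := lt_min_iff.1 hi
      have h3 : ((i + 1 : ℕ) : ℝ) ≤ s.rarr 0 (s.nvar 3) / s.rvar 3 := (Nat.le_floor_iff hq).1 h2
      rw [le_div_iff₀ hδ] at h3
      simp only [BExp.Holds, RExp.eval, NExp.eval, h, hu.rvar _ (by decide : 3 ∉ _),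
        hu.nvar _ (by decide : 1 ∉ _), hu.nvar _ (by decide : 3 ∉ _),
        hu.rarr _ (by decide : 0 ∉ _)]
      exact ⟨by simpa using h1, by simpa using h3⟩
    · simp [NExp.eval, NExp.cost, h]
  · intro s' hu h
    simp only [BExp.Holds, RExp.eval, NExp.eval, h, hu.rvar _ (by decide : 3 ∉ _),
        hu.nvar _ (by decide : 1 ∉ _), hu.nvar _ (by decide : 3 ∉ _),
        hu.rarr _ (by decide : 0 ∉ _)]
    rintro ⟨h1, h2⟩
    simp at h1 h2
    have h4 : N + 1 ≤ ⌊s.rarr 0 (s.nvar 3) / s.rvar 3⌋₊ :=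
      (Nat.le_floor_iff hq).2 ((le_div_iff₀ hδ).2 (by simpa using h2))
    omega
  · rintro t s' - ⟨ht, h⟩
    refine ⟨?_, h⟩
    simp [BExp.cost, RExp.cost, NExp.cost] at ht ⊢
    have : N ≤ s.nvar 1 + 1 := min_le_left _ _
    omega

/-- Arrays `2` and `3`: the rounded sizes of all outcomes and the probabilities of rounding up. -/
def roundSizes : Prog :=
  .loop (.nlt (.var 3) (.var 2)) <|
    .seq floorSize <|
    .seq (.putN 2 (.var 3) (.var 4)) <|
    .seq (.putN 3 (.var 3) (.add (.var 4) (.lit 1))) <|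
    .seq (.ite (.nlt (.var 4) (.add (.var 1) (.lit 1)))
      (.putR 3 (.var 3) (.sub (.div (.get 0 (.var 3)) (.var 3)) (.ofNat (.var 4))))
      (.putR 3 (.var 3) (.ofNat (.lit 0)))) <|
    .setN 3 (.add (.var 3) (.lit 1))

/-- Outcome number `k` has been rounded. -/
structure IsRounded (L : ℕ) (δ : ℝ) (s : Store) (k : ℕ) : Prop where
  hi : s.narr 3 k = s.narr 2 k + 1
  up_nonneg : 0 ≤ s.rarr 3 k
  up_le_one : s.rarr 3 k ≤ 1
  size_eq : s.narr 2 k ≤ L → s.rarr 0 k = (s.narr 2 k + s.rarr 3 k) * δ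
  size_ge : L < s.narr 2 k → (L + 1) * δ ≤ s.rarr 0 k

theorem wp_roundSizes (s : Store) (hδ : 0 < s.rvar 3) (h3 : s.nvar 3 = 0)
    (hx : ∀ k < s.nvar 2, 0 ≤ s.rarr 0 k) :
    wp roundSizes s fun t s' =>
      t ≤ 100 * (s.nvar 1 + 1) * (s.nvar 2 + 1) ∧
      ∀ k < s.nvar 2, IsRounded (s.nvar 1) (s.rvar 3) s' k := by
  refine wp_mono (wp_loop (fun i s' => s'.nvar 3 = i ∧
    ∀ k < i, IsRounded (s.nvar 1) (s.rvar 3) s' k) (s.nvar 2)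
    (fun _ => 40 * (s.nvar 1 + 1) + 30) ⟨h3, by simp⟩ ?_ ?_) ?_
  · rintro i hi s' hu ⟨h, hr⟩
    have u1 := hu.nvar 1 (by decide)
    have u2 := hu.nvar 2 (by decide)
    have u3 := hu.rvar 3 (by decide)
    have u4 := hu.rarr 0 (by decide)
    refine ⟨by simpa [BExp.Holds, NExp.eval, h, u2] using hi, wp_seq ?_⟩
    refine wp_mono (wp_floorSize s' (by rwa [u3]) (by rw [u4, h]; exact hx i hi)) ?_
    rintro t s₁ v ⟨ht, h4⟩
    have v1 := v.nvar 1 (by decide)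
    have v3 := v.nvar 3 (by decide)
    have v4 := v.rvar 3 (by decide)
    have v5 := v.rarr 0 (by decide)
    have v6 := v.rarr 3 (by decide)
    have v7 := v.narr 2 (by decide)
    have v8 := v.narr 3 (by decide)
    rw [u1] at ht
    rw [u1, u3, u4, h] at h4
    rw [u1] at v1
    rw [u3] at v4
    rw [u4] at v5
    rw [h] at v3
    have hq : 0 ≤ s.rarr 0 i / s.rvar 3 := div_nonneg (hx i hi) hδ.le
    -- Outcomes rounded in earlier passes stay valid, because the present pass writes only at
    -- position `i`.
    have old : ∀ k < i, ∀ s₂ : Store, s₂.narr 2 k = s₁.narr 2 k → s₂.narr 3 k = s₁.narr 3 k →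
        s₂.rarr 3 k = s₁.rarr 3 k → s₂.rarr 0 = s₁.rarr 0 →
        IsRounded (s.nvar 1) (s.rvar 3) s₂ k := by
      intro k hk s₂ e1 e2 e3 e4
      have := hr k hk
      refine ⟨?_, ?_, ?_, ?_, ?_⟩
      · rw [e1, e2, v7, v8]; exact this.hi
      · rw [e3, v6]; exact this.up_nonneg
      · rw [e3, v6]; exact this.up_le_one
      · rw [e1, e3, e4, v5, v6, v7, ← u4]; exact this.size_eq
      · rw [e1, e4, v5, v7, ← u4]; exact this.size_ge
    refine wp_seq (wp_putN (wp_seq (wp_putN (wp_seq (wp_ite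
      (fun hb => wp_putR (wp_setN ⟨?_, ?_, fun k hk => ?_⟩))
      (fun hb => wp_putR (wp_setN ⟨?_, ?_, fun k hk => ?_⟩)))))))
    · simp [BExp.cost, RExp.cost, NExp.cost]; omega
    · simp [NExp.eval, v3]
    · simp [BExp.Holds, NExp.eval, v1] at hb
      rcases Nat.lt_succ_iff_lt_or_eq.1 hk with hk | rfl
      · refine old k hk _ ?_ ?_ ?_ ?_ <;> simp [NExp.eval, v3, Function.update_of_ne hk.ne]
      · have hf : s₁.nvar 4 = ⌊s.rarr 0 k / s.rvar 3⌋₊ := by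
          rw [h4] at hb ⊢; omega
        refine ⟨?_, ?_, ?_, ?_, ?_⟩
        · simp [NExp.eval, v3]
        · simpa [NExp.eval, RExp.eval, v3, v4, v5, hf] using Nat.floor_le hq
        · simpa [NExp.eval, RExp.eval, v3, v4, v5, hf, add_comm] using
            (Nat.lt_floor_add_one (s.rarr 0 k / s.rvar 3)).le
        · simp [NExp.eval, RExp.eval, v3, v4, v5, hδ.ne']
        · simp [NExp.eval, v3]; omega
    · simp [BExp.cost, RExp.cost, NExp.cost]; omega
    · simp [NExp.eval, v3]
    · simp [BExp.Holds, NExp.eval, v1] at hb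
      rcases Nat.lt_succ_iff_lt_or_eq.1 hk with hk | rfl
      · refine old k hk _ ?_ ?_ ?_ ?_ <;> simp [NExp.eval, v3, Function.update_of_ne hk.ne]
      · have hf : s.nvar 1 + 1 ≤ ⌊s.rarr 0 k / s.rvar 3⌋₊ := by omega
        refine ⟨?_, ?_, ?_, ?_, ?_⟩
        · simp [NExp.eval, v3]
        · simp [NExp.eval, RExp.eval, v3]
        · simp [NExp.eval, RExp.eval, v3]
        · simp [NExp.eval, v3]; omega
        · have := (le_div_iff₀ hδ).1 ((Nat.le_floor_iff hq).1 hf)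
          intro _
          simpa [NExp.eval, v3, v5] using this
  · rintro s' hu ⟨h, -⟩
    simp [BExp.Holds, NExp.eval, h, hu.nvar _ (by decide : 2 ∉ _)]
  · rintro t s' - ⟨ht, -, h⟩
    refine ⟨?_, h⟩
    simp [BExp.cost, NExp.cost] at ht
    nlinarith


/-! ### The dynamic program -/

/-- Real variable `4`: add `w` times the reward of outcome number `10` at the total rounded size
`6` plus `m`. -/
def addReward (w : RExp) (m : NExp) : Prog :=
  .ite (.nlt (.add (.var 6) m) (.add (.var 1) (.lit 1)))
    (.setR 4 (.add (.var 4) (.mul w (.add (.get 2 (.var 10)) (.get 4 (.add (.var 6) m))))))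
    (.setN 13 (.lit 0))

theorem wp_addReward (w : RExp) (m : NExp) (s : Store) :
    wp (addReward w m) s fun t s' => t ≤ w.cost + 2 * m.cost + 20 ∧
      s'.rvar 4 = s.rvar 4 +
        w.eval s * reward (s.nvar 1) (s.rarr 4) (s.rarr 2 (s.nvar 10)) (s.nvar 6 + m.eval s) := by
  refine wp_ite (fun h => wp_setR ⟨?_, ?_⟩) fun h => wp_setN ⟨?_, ?_⟩
  · simp [BExp.cost, RExp.cost, NExp.cost]; omega
  · simp only [BExp.Holds, NExp.eval] at h
    simp [RExp.eval, NExp.eval, reward, Nat.lt_succ_iff.1 h]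
  · simp [BExp.cost, NExp.cost]; omega
  · simp only [BExp.Holds, NExp.eval] at h
    simp [reward, show ¬ s.nvar 6 + m.eval s ≤ s.nvar 1 by omega]

/-- Adds outcome number `9` of item `7`, whose outcomes start at position `8`, to the backup and
to the probability of a nonzero rounded size, in the real variables `4` and `5`. -/
def backupOutcome : Prog :=
  .seq (.setN 10 (.add (.var 8) (.var 9))) <|
  .seq (addReward (.mul (.get 1 (.var 10)) (.sub (.ofNat (.lit 1)) (.get 3 (.var 10))))
    (.get 2 (.var 10))) <|
  .seq (addReward (.mul (.get 1 (.var 10)) (.get 3 (.var 10)))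
    (.add (.get 2 (.var 10)) (.lit 1))) <|
  .seq (.ite (.nlt (.lit 0) (.get 2 (.var 10)))
    (.setR 5 (.add (.var 5) (.get 1 (.var 10))))
    (.setR 5 (.add (.var 5) (.mul (.get 1 (.var 10)) (.get 3 (.var 10)))))) <|
  .setN 9 (.add (.var 9) (.lit 1))

theorem wp_backupOutcome (s : Store) {k : ℕ} (hk : s.nvar 8 + s.nvar 9 = k) :
    wp backupOutcome s fun t s' => t ≤ 120 ∧ s'.nvar 9 = s.nvar 9 + 1 ∧
      s'.rvar 4 = s.rvar 4 + s.rarr 1 k *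
        ((1 - s.rarr 3 k) *
            reward (s.nvar 1) (s.rarr 4) (s.rarr 2 k) (s.nvar 6 + s.narr 2 k) +
          s.rarr 3 k *
            reward (s.nvar 1) (s.rarr 4) (s.rarr 2 k) (s.nvar 6 + (s.narr 2 k + 1))) ∧
      s'.rvar 5 = s.rvar 5 + s.rarr 1 k * (if s.narr 2 k = 0 then s.rarr 3 k else 1) := by
  refine wp_seq (wp_setN (wp_seq (wp_mono (wp_addReward _ _ _) ?_)))
  rintro t₁ s₁ u ⟨ht₁, h₁⟩
  refine wp_seq (wp_mono (wp_addReward _ _ _) ?_)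
  rintro t₂ s₂ v ⟨ht₂, h₂⟩
  have w1 : s₂.nvar 9 = s.nvar 9 := by
    rw [v.nvar 9 (by decide), u.nvar 9 (by decide)]; simp
  have w2 : s₂.nvar 10 = k := by
    rw [v.nvar 10 (by decide), u.nvar 10 (by decide)]; simp [NExp.eval, hk]
  have w3 : s₂.rvar 5 = s.rvar 5 := by
    rw [v.rvar 5 (by decide), u.rvar 5 (by decide)]
  have w4 : s₂.rarr = s.rarr := by
    funext a
    rw [v.rarr a List.not_mem_nil, u.rarr a List.not_mem_nil]
  have w5 : s₂.narr = s.narr := by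
    funext a
    rw [v.narr a List.not_mem_nil, u.narr a List.not_mem_nil]
  have u1 : s₁.nvar 1 = s.nvar 1 := by rw [u.nvar 1 (by decide)]; simp
  have u2 : s₁.nvar 10 = k := by rw [u.nvar 10 (by decide)]; simp [NExp.eval, hk]
  have u6 : s₁.nvar 6 = s.nvar 6 := by rw [u.nvar 6 (by decide)]; simp
  have u4 : s₁.rarr = s.rarr := by
    funext a
    rw [u.rarr a List.not_mem_nil]
  have u5 : s₁.narr = s.narr := by
    funext a
    rw [u.narr a List.not_mem_nil]
  simp only [RExp.eval, NExp.eval, u1, u2, u6, u4, u5] at h₂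
  simp [RExp.eval, NExp.eval, hk] at h₁
  simp [RExp.cost, NExp.cost] at ht₁ ht₂
  have h4 : s₂.rvar 4 = s.rvar 4 + s.rarr 1 k *
        ((1 - s.rarr 3 k) *
            reward (s.nvar 1) (s.rarr 4) (s.rarr 2 k) (s.nvar 6 + s.narr 2 k) +
          s.rarr 3 k *
            reward (s.nvar 1) (s.rarr 4) (s.rarr 2 k) (s.nvar 6 + (s.narr 2 k + 1))) := by
    rw [h₂, h₁]; ring
  refine wp_seq (wp_ite (fun h => wp_setR (wp_setN ⟨?_, ?_, ?_, ?_⟩))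
    fun h => wp_setR (wp_setN ⟨?_, ?_, ?_, ?_⟩))
  · simp [BExp.cost, RExp.cost, NExp.cost]; omega
  · simp [NExp.eval, w1]
  · simpa using h4
  · simp [BExp.Holds, NExp.eval, w2, w5] at h
    simp [RExp.eval, NExp.eval, w2, w3, w4, h.ne']
  · simp [BExp.cost, RExp.cost, NExp.cost]; omega
  · simp [NExp.eval, w1]
  · simpa using h4
  · simp [BExp.Holds, NExp.eval, w2, w5] at h
    simp [RExp.eval, NExp.eval, w2, w3, w4, h]

/-- Rounded sizes as they are stored in memory. -/
def loOf (I : Instance) (s : Store) (i j : ℕ) : ℕ := s.narr 2 (I.offset i + j)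

/-- Probabilities of rounding up as they are stored in memory. -/
def upOf (I : Instance) (s : Store) (i j : ℕ) : ℝ := s.rarr 3 (I.offset i + j)

/-- Real variables `4` and `5`: the backup of item `7` and its probability of a nonzero rounded
size. -/
def backupItem : Prog :=
  .seq (.setN 9 (.lit 0)) <| .seq (.setR 4 (.ofNat (.lit 0))) <| .seq (.setR 5 (.ofNat (.lit 0))) <|
  .loop (.nlt (.var 9) (.get 0 (.var 7))) backupOutcome

theorem wp_backupItem {I : Instance} {s : Store} (hs : HoldsItems I s) {i : ℕ}
    (h7 : s.nvar 7 = i) (h8 : s.nvar 8 = I.offset i) :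
    wp backupItem s fun t s' => t ≤ 150 * ((I.item i).length + 1) ∧
      s'.rvar 4 = backup I (s.nvar 1) (loOf I s) (upOf I s) (s.rarr 4) (s.nvar 6) i ∧
      s'.rvar 5 = moveProb I (loOf I s) (upOf I s) i := by
  refine wp_seq (wp_setN (wp_seq (wp_setR (wp_seq (wp_setR (wp_mono
    (wp_loop (fun j s' => s'.nvar 9 = j ∧
      s'.rvar 4 = ∑ j ∈ Finset.range j, (I.outcome i j).prob *
        ((1 - upOf I s i j) * reward (s.nvar 1) (s.rarr 4) (I.outcome i j).profit
            (s.nvar 6 + loOf I s i j) +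
          upOf I s i j * reward (s.nvar 1) (s.rarr 4) (I.outcome i j).profit
            (s.nvar 6 + (loOf I s i j + 1))) ∧
      s'.rvar 5 = ∑ j ∈ Finset.range j, (I.outcome i j).prob *
        (if loOf I s i j = 0 then upOf I s i j else 1)) (I.item i).length (fun _ => 120)
      ?_ ?_ ?_) ?_))))))
  · simp [NExp.eval, RExp.eval]
  · rintro j hj s' hu ⟨h9, h4, h5⟩
    have u1 : s'.nvar 1 = s.nvar 1 := by rw [hu.nvar 1 (by decide)]; simp
    have u6 : s'.nvar 6 = s.nvar 6 := by rw [hu.nvar 6 (by decide)]; simp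
    have u7 : s'.nvar 7 = i := by rw [hu.nvar 7 (by decide)]; simp [h7]
    have u8 : s'.nvar 8 = I.offset i := by rw [hu.nvar 8 (by decide)]; simp [h8]
    have ua : s'.rarr = s.rarr := by
      funext a
      rw [hu.rarr a List.not_mem_nil]
    have un : s'.narr = s.narr := by
      funext a
      rw [hu.narr a List.not_mem_nil]
    refine ⟨by simpa [BExp.Holds, NExp.eval, h9, u7, un, hs.length] using hj, ?_⟩
    refine wp_mono (wp_backupOutcome s' (k := I.offset i + j) (by rw [u8, h9])) ?_
    rintro t s'' - ⟨ht, e9, e4, e5⟩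
    rw [u1, u6, ua, un, hs.prob i j hj, hs.profit i j hj, h4] at e4
    rw [ua, un, hs.prob i j hj, h5] at e5
    exact ⟨ht, by rw [e9, h9], by rw [e4, Finset.sum_range_succ]; rfl,
      by rw [e5, Finset.sum_range_succ]; rfl⟩
  · rintro s' hu ⟨h9, -⟩
    have u7 : s'.nvar 7 = i := by rw [hu.nvar 7 (by decide)]; simp [h7]
    have un : s'.narr = s.narr := by
      funext a
      rw [hu.narr a List.not_mem_nil]
    simp [BExp.Holds, NExp.eval, h9, u7, un, hs.length]
  · rintro t s' - ⟨ht, -, h4, h5⟩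
    refine ⟨?_, h4, h5⟩
    simp [BExp.cost, RExp.cost, NExp.cost] at ht ⊢
    omega

/-! ### The best item at each total and the table -/

/-- `b` is the greatest ratio `g i / m i` with `i < n` and `m i > 0`, or zero if all are negative
or there is none; `a` is the position of this ratio plus one, or zero. -/
structure IsBest (g m : ℕ → ℝ) (n : ℕ) (b : ℝ) (a : ℕ) : Prop where
  nonneg : 0 ≤ b
  le : ∀ i < n, 0 < m i → g i ≤ m i * b
  eq_zero : a = 0 → b = 0
  attained : ∀ i, a = i + 1 → i < n ∧ 0 < m i ∧ g i = m i * b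

theorem IsBest.zero (g m : ℕ → ℝ) : IsBest g m 0 0 0 :=
  ⟨le_rfl, by simp, fun _ => rfl, by simp⟩

theorem IsBest.keep {g m : ℕ → ℝ} {n : ℕ} {b : ℝ} {a : ℕ} (h : IsBest g m n b a)
    (hn : 0 < m n → g n ≤ m n * b) : IsBest g m (n + 1) b a :=
  ⟨h.nonneg, fun i hi => (Nat.lt_succ_iff_lt_or_eq.1 hi).elim (h.le i) (fun e => e ▸ hn),
    h.eq_zero, fun i hi => ⟨(h.attained i hi).1.trans n.lt_succ_self, (h.attained i hi).2⟩⟩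

theorem IsBest.improve {g m : ℕ → ℝ} {n : ℕ} {b : ℝ} {a : ℕ} (h : IsBest g m n b a)
    (hm : 0 < m n) (hb : b < g n / m n) : IsBest g m (n + 1) (g n / m n) (n + 1) := by
  have e : g n = m n * (g n / m n) := by field_simp
  refine ⟨h.nonneg.trans hb.le, fun i hi hi' => ?_, by simp, fun i hi => ?_⟩
  · rcases Nat.lt_succ_iff_lt_or_eq.1 hi with hi | rfl
    · exact (h.le i hi hi').trans (mul_le_mul_of_nonneg_left hb.le hi'.le)
    · exact e.le
  · obtain rfl : n = i := by omega
    exact ⟨n.lt_succ_self, hm, e⟩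

/-- If `f` is not zero, then item `f - 1` takes no space after rounding and is profitable. -/
def IsFree (I : Instance) (L : ℕ) (lo : ℕ → ℕ → ℕ) (up : ℕ → ℕ → ℝ) (f : ℕ) : Prop :=
  ∀ i, f = i + 1 → i < I.items.length ∧ moveProb I lo up i ≤ 0 ∧
    ∃ s V, s ≤ L ∧ 0 < properBackup I L lo up V s i

/-- Takes the item whose backup and probability of a nonzero rounded size are in the real
variables `4` and `5` into account. -/
def compareItem : Prog :=
  .ite (.rlt (.ofNat (.lit 0)) (.var 5))
    (.ite (.rlt (.var 6) (.div (.var 4) (.var 5)))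
      (.seq (.setR 6 (.div (.var 4) (.var 5))) (.setN 11 (.add (.var 7) (.lit 1))))
      (.setN 13 (.lit 0)))
    (.ite (.rlt (.ofNat (.lit 0)) (.var 4))
      (.setN 12 (.add (.var 7) (.lit 1)))
      (.setN 13 (.lit 0)))

theorem wp_compareItem {g m : ℕ → ℝ} {s : Store} (h4 : s.rvar 4 = g (s.nvar 7))
    (h5 : s.rvar 5 = m (s.nvar 7)) (hb : IsBest g m (s.nvar 7) (s.rvar 6) (s.nvar 11)) :
    wp compareItem s fun t s' => t ≤ 30 ∧
      IsBest g m (s.nvar 7 + 1) (s'.rvar 6) (s'.nvar 11) ∧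
      (s'.nvar 12 = s.nvar 12 ∧ (m (s.nvar 7) ≤ 0 → g (s.nvar 7) ≤ 0) ∨
        s'.nvar 12 = s.nvar 7 + 1 ∧ m (s.nvar 7) ≤ 0 ∧ 0 < g (s.nvar 7)) := by
  refine wp_ite (fun h1 => wp_ite (fun h2 => wp_seq (wp_setR (wp_setN ?_))) fun h2 => wp_setN ?_)
    fun h1 => wp_ite (fun h2 => wp_setN ?_) fun h2 => wp_setN ?_ <;>
  simp only [BExp.Holds, RExp.eval, NExp.eval, h4, h5, Nat.cast_zero, not_lt] at h1 h2
  · simp [BExp.cost, RExp.cost, NExp.cost, RExp.eval, NExp.eval, h4, h5, hb.improve h1 h2,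
      not_le.2 h1]
  · have := hb.keep fun _ => by rw [mul_comm]; exact (div_le_iff₀ h1).1 h2
    simp [BExp.cost, RExp.cost, NExp.cost, this, not_le.2 h1]
  · have := hb.keep fun h => absurd h1 (not_le.2 h)
    simp [BExp.cost, RExp.cost, NExp.cost, NExp.eval, this, h1, h2]
  · have := hb.keep fun h => absurd h1 (not_le.2 h)
    simp [BExp.cost, RExp.cost, NExp.cost, this, h2]

/-- Real variable `6` and natural variable `11`: the value at the total rounded size `6`, and the
best item plus one.  Natural variable `12` records a free item plus one, if there is one. -/
def bestItem : Prog :=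
  .seq (.setN 7 (.lit 0)) <| .seq (.setN 8 (.lit 0)) <| .seq (.setN 11 (.lit 0)) <|
  .seq (.setR 6 (.ofNat (.lit 0))) <|
  .loop (.nlt (.var 7) (.var 0)) <|
    .seq backupItem <| .seq compareItem <|
    .seq (.setN 8 (.add (.var 8) (.get 0 (.var 7)))) (.setN 7 (.add (.var 7) (.lit 1)))

theorem wp_bestItem {I : Instance} {s : Store} (hs : HoldsItems I s)
    (h6 : s.nvar 6 ≤ s.nvar 1) (hA : s.rarr 4 (s.nvar 6) = 0)
    (hf : IsFree I (s.nvar 1) (loOf I s) (upOf I s) (s.nvar 12)) :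
    wp bestItem s fun t s' =>
      t ≤ 200 * (I.items.length + I.offset I.items.length + 1) ∧
      IsBest (properBackup I (s.nvar 1) (loOf I s) (upOf I s) (s.rarr 4) (s.nvar 6))
        (moveProb I (loOf I s) (upOf I s)) I.items.length (s'.rvar 6) (s'.nvar 11) ∧
      IsFree I (s.nvar 1) (loOf I s) (upOf I s) (s'.nvar 12) ∧
      (s'.nvar 12 = 0 → s.nvar 12 = 0 ∧ ∀ i < I.items.length,
        moveProb I (loOf I s) (upOf I s) i ≤ 0 →
          properBackup I (s.nvar 1) (loOf I s) (upOf I s) (s.rarr 4) (s.nvar 6) i ≤ 0) := by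
  -- The entry of the current state is still zero, so the backup computed by the program is the
  -- proper one.
  have hA' : Function.update (s.rarr 4) (s.nvar 6) 0 = s.rarr 4 := by
    rw [← hA, Function.update_eq_self]
  have hpb : ∀ i, backup I (s.nvar 1) (loOf I s) (upOf I s) (s.rarr 4) (s.nvar 6) i =
      properBackup I (s.nvar 1) (loOf I s) (upOf I s) (s.rarr 4) (s.nvar 6) i := by
    intro i; rw [properBackup, hA']
  set m := moveProb I (loOf I s) (upOf I s) with hm
  set g := properBackup I (s.nvar 1) (loOf I s) (upOf I s) (s.rarr 4) (s.nvar 6) with hg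
  have hsum : ∀ n, ∑ i ∈ Finset.range n, (I.item i).length = I.offset n := by
    intro n
    induction n with
    | zero => simp [Instance.offset]
    | succ n ih => rw [Finset.sum_range_succ, ih, I.offset_succ]
  refine wp_seq (wp_setN (wp_seq (wp_setN (wp_seq (wp_setN (wp_seq (wp_setR (wp_mono
    (wp_loop (fun i s' => s'.nvar 7 = i ∧ s'.nvar 8 = I.offset i ∧
      IsBest g m i (s'.rvar 6) (s'.nvar 11) ∧
      IsFree I (s.nvar 1) (loOf I s) (upOf I s) (s'.nvar 12) ∧
      (s'.nvar 12 = 0 → s.nvar 12 = 0 ∧ ∀ k < i, m k ≤ 0 → g k ≤ 0)) I.items.length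
      (fun i => 150 * ((I.item i).length + 1) + 45) ?_ ?_ ?_) ?_))))))))
  · simpa [NExp.eval, RExp.eval, IsBest.zero, Instance.offset] using hf
  · rintro i hi s' hu ⟨h7, h8, hb, hfr, hz⟩
    have u0 : s'.nvar 0 = s.nvar 0 := by rw [hu.nvar 0 (by decide)]; simp
    have u1 : s'.nvar 1 = s.nvar 1 := by rw [hu.nvar 1 (by decide)]; simp
    have u6 : s'.nvar 6 = s.nvar 6 := by rw [hu.nvar 6 (by decide)]; simp
    have ua : s'.rarr = s.rarr := by
      funext a
      rw [hu.rarr a List.not_mem_nil]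
    have un : s'.narr = s.narr := by
      funext a
      rw [hu.narr a List.not_mem_nil]
    have hs' : HoldsItems I s' := ⟨by rw [u0, hs.num], by rw [un]; exact hs.length,
      by rw [ua]; exact hs.size, by rw [ua]; exact hs.prob, by rw [ua]; exact hs.profit⟩
    have ulo : loOf I s' = loOf I s := by unfold loOf; rw [un]
    have uup : upOf I s' = upOf I s := by unfold upOf; rw [ua]
    refine ⟨by simpa [BExp.Holds, NExp.eval, h7, u0, hs.num] using hi, wp_seq ?_⟩
    refine wp_mono (wp_backupItem hs' h7 h8) ?_
    rintro t₁ s₁ v ⟨ht₁, e4, e5⟩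
    rw [u1, ulo, uup, ua, u6, hpb] at e4
    rw [ulo, uup, ← hm] at e5
    have v7 : s₁.nvar 7 = i := by rw [v.nvar 7 (by decide), h7]
    have v8 : s₁.nvar 8 = I.offset i := by rw [v.nvar 8 (by decide), h8]
    have v11 := v.nvar 11 (by decide)
    have v12 := v.nvar 12 (by decide)
    have v6 := v.rvar 6 (by decide)
    have vn : s₁.narr = s'.narr := by
      funext a
      rw [v.narr a List.not_mem_nil]
    refine wp_seq (wp_mono (wp_compareItem (g := g) (m := m) (by rw [e4, v7]) (by rw [e5, v7])
      (by rw [v6, v7, v11]; exact hb)) ?_)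
    rintro t₂ s₂ w ⟨ht₂, hb', hf'⟩
    have w7 : s₂.nvar 7 = i := by rw [w.nvar 7 (by decide), v7]
    have w8 : s₂.nvar 8 = I.offset i := by rw [w.nvar 8 (by decide), v8]
    have wn : s₂.narr = s'.narr := by
      funext a
      rw [w.narr a List.not_mem_nil, vn]
    rw [v7] at hb' hf'
    refine wp_seq (wp_setN (wp_setN ⟨?_, ?_, ?_, ?_, ?_, ?_⟩))
    · simp [NExp.cost]; omega
    · simp [NExp.eval, w7]
    · simp [NExp.eval, w7, w8, wn, hs'.length, I.offset_succ]
    · simpa using hb'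
    · simp only [ne_eq, Nat.reduceEqDiff, not_false_eq_true, Function.update_of_ne]
      rcases hf' with ⟨h, -⟩ | ⟨h, h', h''⟩
      · rwa [h, v12]
      · intro i' hi'
        obtain rfl : i = i' := by omega
        exact ⟨hi, h', s.nvar 6, s.rarr 4, h6, h''⟩
    · simp only [ne_eq, Nat.reduceEqDiff, not_false_eq_true, Function.update_of_ne]
      intro h0
      rcases hf' with ⟨h, h'⟩ | ⟨h, -⟩
      · rw [h, v12] at h0
        refine ⟨(hz h0).1, fun k hk => ?_⟩
        rcases Nat.lt_succ_iff_lt_or_eq.1 hk with hk | rfl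
        · exact (hz h0).2 k hk
        · exact h'
      · omega
  · rintro s' hu ⟨h7, -⟩
    have u0 : s'.nvar 0 = s.nvar 0 := by rw [hu.nvar 0 (by decide)]; simp
    simp [BExp.Holds, NExp.eval, h7, u0, hs.num]
  · rintro t s' - ⟨ht, -, -, hb, hfr, hz⟩
    refine ⟨?_, hb, hfr, hz⟩
    simp only [BExp.cost, NExp.cost, Finset.sum_add_distrib, ← Finset.mul_sum, hsum,
      Finset.sum_const, Finset.card_range, smul_eq_mul] at ht
    simp [RExp.cost, NExp.cost]
    omega

/-- Arrays `4` and `1`: the values and the decisions for all total rounded sizes. -/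
def fillTable : Prog :=
  .loop (.nlt (.var 5) (.add (.var 1) (.lit 1))) <|
    .seq (.setN 6 (.sub (.var 1) (.var 5))) <| .seq bestItem <|
    .seq (.putR 4 (.var 6) (.var 6)) <| .seq (.putN 1 (.var 6) (.var 11)) <|
    .setN 5 (.add (.var 5) (.lit 1))

/-- After `τ` passes exactly the totals above `L - τ`, up to `L`, are final. Unfilled entries are
still zero, as is needed to process the next state, and a free item seen at any state remains
recorded. -/
theorem wp_fillTable {I : Instance} {s : Store} (hs : HoldsItems I s) (h5 : s.nvar 5 = 0)
    (h12 : s.nvar 12 = 0) (hA : ∀ x, s.rarr 4 x = 0) :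
    wp fillTable s fun t s' =>
      t ≤ 250 * (s.nvar 1 + 1) * (I.items.length + I.offset I.items.length + 1) ∧
      (∀ x, s.nvar 1 < x → s'.rarr 4 x = 0) ∧
      (∀ x ≤ s.nvar 1,
        IsBest (properBackup I (s.nvar 1) (loOf I s) (upOf I s) (s'.rarr 4) x)
          (moveProb I (loOf I s) (upOf I s)) I.items.length (s'.rarr 4 x) (s'.narr 1 x)) ∧
      IsFree I (s.nvar 1) (loOf I s) (upOf I s) (s'.nvar 12) ∧
      (s'.nvar 12 = 0 → ∀ x ≤ s.nvar 1, ∀ i < I.items.length,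
        moveProb I (loOf I s) (upOf I s) i ≤ 0 →
          properBackup I (s.nvar 1) (loOf I s) (upOf I s) (s'.rarr 4) x i ≤ 0) := by
  set L := s.nvar 1 with hL
  set m := moveProb I (loOf I s) (upOf I s) with hm
  set g := properBackup I L (loOf I s) (upOf I s) with hg
  refine wp_mono (wp_loop (fun τ s' => s'.nvar 5 = τ ∧ (∀ x, L < x ∨ x + τ ≤ L → s'.rarr 4 x = 0) ∧
      (∀ x ≤ L, L < x + τ →
        IsBest (g (s'.rarr 4) x) m I.items.length (s'.rarr 4 x) (s'.narr 1 x)) ∧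
      IsFree I L (loOf I s) (upOf I s) (s'.nvar 12) ∧
      (s'.nvar 12 = 0 → ∀ x ≤ L, L < x + τ → ∀ i < I.items.length, m i ≤ 0 →
        g (s'.rarr 4) x i ≤ 0)) (L + 1)
      (fun _ => 200 * (I.items.length + I.offset I.items.length + 1) + 25) ?_ ?_ ?_) ?_
  · refine ⟨h5, fun x _ => hA x, fun x _ _ => by omega, ?_, fun _ x _ _ => by omega⟩
    intro i hi
    omega
  · rintro τ hτ s' hu ⟨e5, hz, hb, hf, hn⟩
    have u1 : s'.nvar 1 = L := by rw [hu.nvar 1 (by decide)]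
    have hs' : HoldsItems I s' := hs.of_unchanged hu (by decide) (by decide) (by decide)
    have ulo : loOf I s' = loOf I s := by unfold loOf; rw [hu.narr 2 (by decide)]
    have uup : upOf I s' = upOf I s := by unfold upOf; rw [hu.rarr 3 (by decide)]
    refine ⟨by simpa [BExp.Holds, NExp.eval, e5, u1] using hτ, wp_seq (wp_setN (wp_seq ?_))⟩
    have key := wp_bestItem (I := I)
      (s := { s' with nvar := Function.update s'.nvar 6 (((NExp.var 1).sub (.var 5)).eval s') })
      ⟨by simpa using hs'.num, hs'.length, hs'.size, hs'.prob, hs'.profit⟩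
      (by simp [NExp.eval]) (by simpa [NExp.eval, u1, e5] using hz _ (by omega)) (by
        change IsFree I _ (loOf I s') (upOf I s') _
        rw [ulo, uup]
        simpa [u1] using hf)
    refine wp_mono key ?_
    change ∀ t s₁, _ → (_ ∧ IsBest (properBackup I _ (loOf I s') (upOf I s') _ _)
      (moveProb I (loOf I s') (upOf I s')) _ _ _ ∧ IsFree I _ (loOf I s') (upOf I s') _ ∧
      (_ → _ ∧ ∀ i < _, moveProb I (loOf I s') (upOf I s') i ≤ 0 →
        properBackup I _ (loOf I s') (upOf I s') _ _ _ ≤ 0)) → _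
    rw [ulo, uup]
    simp only [NExp.eval, ne_eq, OfNat.one_ne_ofNat, Nat.reduceEqDiff, not_false_eq_true,
      Function.update_of_ne, Function.update_self, u1, e5]
    rw [← hm, ← hg]
    rintro t s₁ v ⟨ht, hb', hf', hn'⟩
    have v5 : s₁.nvar 5 = τ := by rw [v.nvar 5 (by decide)]; simp [e5]
    have v6 : s₁.nvar 6 = L - τ := by rw [v.nvar 6 (by decide)]; simp
    have v4 : s₁.rarr 4 = s'.rarr 4 := by rw [v.rarr 4 (by decide)]
    have vn : s₁.narr 1 = s'.narr 1 := by rw [v.narr 1 (by decide)]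
    -- Writing the value at `L - τ` affects neither its own proper backup nor those of larger
    -- totals.
    have hcong : ∀ x ≤ L, L ≤ x + τ →
        g (Function.update (s'.rarr 4) (L - τ) (s₁.rvar 6)) x = g (s'.rarr 4) x := by
      intro x hx hxτ
      funext i
      refine properBackup_congr (fun y hy _ => ?_) i
      rw [Function.update_of_ne (by omega)]
    refine wp_seq (wp_putR (wp_seq (wp_putN (wp_setN ⟨?_, ?_, ?_, ?_, ?_, ?_⟩))))
    · simp [NExp.cost, RExp.cost]; omega
    · simp [NExp.eval, v5]
    · intro x hx
      simp only [NExp.eval, v6, Function.update_self, v4]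
      rw [Function.update_of_ne (by omega)]
      exact hz x (by omega)
    · intro x hx hxτ
      simp only [NExp.eval, RExp.eval, v6, Function.update_self, v4, vn]
      rw [hcong x hx (by omega)]
      rcases eq_or_ne x (L - τ) with rfl | hne
      · simpa using hb'
      · rw [Function.update_of_ne hne, Function.update_of_ne hne]
        exact hb x hx (by omega)
    · simpa using hf'
    · simp only [NExp.eval, RExp.eval, v6, Function.update_self, v4, ne_eq, Nat.reduceEqDiff,
        not_false_eq_true, Function.update_of_ne]
      intro h0 x hx hxτ
      rw [hcong x hx (by omega)]
      rcases eq_or_ne x (L - τ) with rfl | hne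
      · exact (hn' h0).2
      · exact hn (hn' h0).1 x hx (by omega)
  · rintro s' hu ⟨e5, -⟩
    have u1 : s'.nvar 1 = L := by rw [hu.nvar 1 (by decide)]
    simp [BExp.Holds, NExp.eval, e5, u1]
  · rintro t s' - ⟨ht, -, hz, hb, hf, hn⟩
    refine ⟨?_, fun x hx => hz x (Or.inl hx), fun x hx => hb x hx (by omega), hf,
      fun h0 x hx => hn h0 x hx (by omega)⟩
    simp only [BExp.cost, NExp.cost, Finset.sum_const, Finset.card_range, smul_eq_mul] at ht
    nlinarith


/-! ### The algorithm -/

/-- The approximation scheme: choose the grid, round all sizes, solve the rounded problem; if some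
item is free, insert it forever. -/
def knapsackScheme : Prog :=
  .seq gridUnit <| .seq gridBound <| .seq countOutcomes <| .seq roundSizes <| .seq fillTable <|
  .ite (.nlt (.lit 0) (.var 12)) (.putN 1 (.lit 0) (.var 12)) (.setN 13 (.lit 0))

theorem grid_size_le {C ε δ : ℝ} {L : ℕ} (hC : 0 ≤ C) (hε : 0 < ε)
    (hδ : δ = min ε 1 ^ 3 / (32 * (C + 1)))
    (hL : (L : ℝ) < (C + min ε 1 / 4 + δ) / δ + 1) :
    (L : ℝ) + 1 ≤ 35 * ((1 + C) * (1 + 1 / ε)) ^ 3 := by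
  set e := min ε 1 with he
  have he0 : 0 < e := lt_min hε one_pos
  have he1 : e ≤ 1 := min_le_right _ _
  have hδ0 : 0 < δ := by rw [hδ]; positivity
  set Y := 1 + 1 / ε with hY
  have hY1 : 1 ≤ Y := by
    have : 0 < 1 / ε := by positivity
    linarith
  -- Capping the accuracy at one is harmless: 1/e is the larger of 1/ε and 1, hence at most 1 + 1/ε.
  have hinv : 1 / e ≤ Y := by
    rcases min_cases ε 1 with ⟨h, -⟩ | ⟨h, -⟩
    · rw [he, h]; linarith
    · rw [he, h]; simpa using hY1
  have h1 : (C + e / 4 + δ) / δ = (C + e / 4) * (32 * (C + 1)) * (1 / e) ^ 3 + 1 := by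
    rw [add_div, div_self hδ0.ne', hδ]
    field_simp
  have h2 : (1 / e) ^ 3 ≤ Y ^ 3 := by gcongr
  have h3 : (C + e / 4) * (32 * (C + 1)) ≤ 32 * (1 + C) ^ 3 := by
    have : (C + e / 4) * (32 * (C + 1)) ≤ (1 + C) * (32 * (C + 1)) :=
      mul_le_mul_of_nonneg_right (by linarith) (by linarith)
    have : 0 ≤ C * (1 + C) ^ 2 := by positivity
    nlinarith
  have h4 : (C + e / 4) * (32 * (C + 1)) * (1 / e) ^ 3 ≤ 32 * (1 + C) ^ 3 * Y ^ 3 := by gcongr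
  -- 35 = 32 + 3: the extra units come from δ/δ, from the ceiling and from the `+ 1` in the claim,
  -- and each is at most the cube.
  have h5 : 1 ≤ (1 + C) ^ 3 * Y ^ 3 :=
    one_le_mul_of_one_le_of_one_le (one_le_pow₀ (by linarith)) (one_le_pow₀ hY1)
  rw [mul_pow]
  linarith

theorem isRounding_of_isRounded {I : Instance} {L : ℕ} {δ : ℝ} {s : Store} (hs : HoldsItems I s)
    (h : ∀ k < I.offset I.items.length, IsRounded L δ s k) :
    IsRounding I L δ (loOf I s) (upOf I s) := by
  refine ⟨fun i j hj => ?_, fun i j hj => ?_, fun i j hj => ?_, fun i j hj => ?_⟩ <;>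
  have := h _ (I.offset_add_lt hj)
  · exact this.up_nonneg
  · exact this.up_le_one
  · rw [← hs.size i j hj]; exact this.size_eq
  · rw [← hs.size i j hj]; exact this.size_ge

/-- Items that never move are not seen by the ratio test; for them the optimality inequality is
`hn`, the absence of free items. -/
theorem isSolution_of_isBest {I : Instance} {L : ℕ} {δ : ℝ} {lo : ℕ → ℕ → ℕ} {up : ℕ → ℕ → ℝ}
    {V : ℕ → ℝ} {a : ℕ → ℕ} (hI : I.Valid) (hR : IsRounding I L δ lo up)
    (hz : ∀ x, L < x → V x = 0)
    (hb : ∀ x ≤ L, IsBest (properBackup I L lo up V x) (moveProb I lo up) I.items.length (V x)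
      (a x))
    (hn : ∀ x ≤ L, ∀ i < I.items.length, moveProb I lo up i ≤ 0 →
      properBackup I L lo up V x i ≤ 0) :
    IsSolution I L lo up V fun x => if a x = 0 then none else some (a x - 1) := by
  refine ⟨fun s => ?_, hz, fun s i hs hi => ?_, fun s hs h => ?_, fun s i hs h => ?_⟩
  · rcases le_or_gt s L with h | h
    · exact (hb s h).nonneg
    · exact (hz s h).ge
  · rcases le_or_gt (moveProb I lo up i) 0 with h | h
    · exact (hn s hs i hi h).trans (mul_nonneg (moveProb_nonneg hI hR i) (hb s hs).nonneg)
    · exact (hb s hs).le i hi h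
  · exact (hb s hs).eq_zero (by simpa using h)
  · refine (hb s hs).attained i ?_
    split_ifs at h with h0
    have := Option.some.inj h
    omega

theorem wp_knapsackScheme {I : Instance} {ε : ℝ} (hI : I.Valid) (hε : 0 < ε) :
    wp knapsackScheme (I.encode ε) fun t s =>
      (t : ℝ) ≤ 17500 * I.inputSize * ((1 + I.capacity) * (1 + 1 / ε)) ^ 3 ∧
      (decodePolicy I s).WellFormed I ∧
      ENNReal.ofReal (1 - ε) * OPT I ≤ (decodePolicy I s).expectedProfit I (I.capacity + ε) := by
  have hC := hI.capacity_nonneg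
  set s₀ := I.encode ε with hs₀
  have H₀ : HoldsItems I s₀ := holdsItems_encode I ε
  have a4 : ∀ x, s₀.rarr 4 x = 0 := by
    intro x
    simp only [hs₀, Instance.encode]
    split <;> simp
  refine wp_seq (wp_mono (wp_gridUnit _) ?_)
  rintro t₁ s₁ u₁ ⟨ht₁, he, hδ⟩
  set e := min (s₀.rvar 1) 1 with he'
  set δ := e ^ 3 / (32 * (s₀.rvar 0 + 1)) with hδ'
  have hee : e = min ε 1 := rfl
  have hCC : s₀.rvar 0 = I.capacity := rfl
  have he0 : 0 < e := lt_min hε one_pos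
  have he1 : e ≤ 1 := min_le_right _ _
  rw [hCC] at hδ'
  have hδ0 : 0 < δ := by rw [hδ']; positivity
  have H₁ : HoldsItems I s₁ := H₀.of_unchanged u₁ (by decide) (by decide) (by decide)
  refine wp_seq (wp_mono (wp_gridBound s₁ (by rw [u₁.nvar 1 (by decide)]; rfl)
    (by rw [hδ]; exact hδ0)) ?_)
  rintro t₂ s₂ u₂ ⟨ht₂, hL⟩
  rw [u₁.rvar 0 (by decide), he, hδ, hCC] at hL
  have H₂ : HoldsItems I s₂ := H₁.of_unchanged u₂ (by decide) (by decide) (by decide)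
  set L := s₂.nvar 1 with hL'
  refine wp_seq (wp_mono (wp_countOutcomes H₂
    (by rw [u₂.nvar 2 (by decide), u₁.nvar 2 (by decide)]; rfl)
    (by rw [u₂.nvar 7 (by decide), u₁.nvar 7 (by decide)]; rfl)) ?_)
  rintro t₃ s₃ u₃ ⟨ht₃, hm⟩
  have H₃ : HoldsItems I s₃ := H₂.of_unchanged u₃ (by decide) (by decide) (by decide)
  have c3 : s₃.rvar 3 = δ := by rw [u₃.rvar 3 (by decide), u₂.rvar 3 (by decide), hδ]
  have l3 : s₃.nvar 1 = L := by rw [u₃.nvar 1 (by decide)]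
  refine wp_seq (wp_mono (wp_roundSizes s₃ (by rw [c3]; exact hδ0)
    (by rw [u₃.nvar 3 (by decide), u₂.nvar 3 (by decide), u₁.nvar 3 (by decide)]; rfl) ?_) ?_)
  · intro k hk
    rw [hm] at hk
    obtain ⟨i, j, hj, rfl⟩ := I.exists_of_lt_offset hk
    rw [H₃.size i j hj]
    exact hI.outcome_size hj
  rintro t₄ s₄ u₄ ⟨ht₄, hr⟩
  rw [hm, c3, l3] at hr
  rw [hm, l3] at ht₄
  have H₄ : HoldsItems I s₄ := H₃.of_unchanged u₄ (by decide) (by decide) (by decide)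
  have l4 : s₄.nvar 1 = L := by rw [u₄.nvar 1 (by decide), l3]
  have hR := isRounding_of_isRounded H₄ hr
  refine wp_seq (wp_mono (wp_fillTable H₄
    (by rw [u₄.nvar 5 (by decide), u₃.nvar 5 (by decide), u₂.nvar 5 (by decide),
      u₁.nvar 5 (by decide)]; rfl)
    (by rw [u₄.nvar 12 (by decide), u₃.nvar 12 (by decide), u₂.nvar 12 (by decide),
      u₁.nvar 12 (by decide)]; rfl)
    (fun x => by rw [u₄.rarr 4 (by decide), u₃.rarr 4 (by decide), u₂.rarr 4 (by decide),
      u₁.rarr 4 (by decide), a4])) ?_)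
  rintro t₅ s₅ u₅ ⟨ht₅, hz, hb, hf, hn⟩
  rw [l4] at ht₅ hz hb hf hn
  have l5 : s₅.nvar 1 = L := by rw [u₅.nvar 1 (by decide), l4]
  have lo5 : s₅.narr 2 = s₄.narr 2 := u₅.narr 2 (by decide)
  have hi5 : s₅.narr 3 = s₄.narr 3 := u₅.narr 3 (by decide)
  have up5 : s₅.rarr 3 = s₄.rarr 3 := u₅.rarr 3 (by decide)
  -- The 7 is the cost of the final conditional, and 17500 = 500 · 35.
  have htime : ((t₁ + (t₂ + (t₃ + (t₄ + (t₅ + 7)))) : ℕ) : ℝ) ≤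
      17500 * I.inputSize * ((1 + I.capacity) * (1 + 1 / ε)) ^ 3 := by
    have hS := I.length_le_inputSize
    have h1 : t₁ + (t₂ + (t₃ + (t₄ + (t₅ + 7)))) ≤ 500 * ((L + 1) * I.inputSize) := by
      have k1 : (L + 1) * (I.items.length + I.offset I.items.length + 1) ≤
        (L + 1) * I.inputSize := Nat.mul_le_mul_left _ hS
      have k2 : 0 ≤ L * I.items.length := Nat.zero_le _
      have k3 : 0 ≤ L * I.offset I.items.length := Nat.zero_le _
      nlinarith
    have h2 : (L : ℝ) + 1 ≤ 35 * ((1 + I.capacity) * (1 + 1 / ε)) ^ 3 := by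
      refine grid_size_le hC hε hδ' ?_
      rw [hL, ← hee]
      exact Nat.ceil_lt_add_one (by positivity)
    have h3 : ((t₁ + (t₂ + (t₃ + (t₄ + (t₅ + 7)))) : ℕ) : ℝ) ≤
        500 * (((L : ℝ) + 1) * I.inputSize) := by exact_mod_cast h1
    have h4 := mul_le_mul_of_nonneg_right h2 (Nat.cast_nonneg (α := ℝ) I.inputSize)
    linarith
  have hfin : ∀ s : Store, s.nvar 1 = L → s.narr 2 = s₄.narr 2 → s.narr 3 = s₄.narr 3 →
      s.rarr 3 = s₄.rarr 3 →
      (decodePolicy I s).bound = L ∧ (decodePolicy I s).lo = loOf I s₄ ∧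
      (decodePolicy I s).up = upOf I s₄ ∧ (decodePolicy I s).WellFormed I ∧
      ∀ i j, j < (I.item i).length →
        (decodePolicy I s).hi i j = (decodePolicy I s).lo i j + 1 := by
    intro s e1 e2 e3 e4
    have k1 : (decodePolicy I s).lo = loOf I s₄ := by
      unfold decodePolicy loOf; simp only [e2]
    have k2 : (decodePolicy I s).up = upOf I s₄ := by
      unfold decodePolicy upOf; simp only [e4]
    refine ⟨e1, k1, k2, fun i j hj => ?_, fun i j hj => ?_⟩
    · rw [k2]; exact ⟨hR.up_nonneg i j hj, hR.up_le_one i j hj⟩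
    · have := (hr _ (I.offset_add_lt hj)).hi
      simp only [decodePolicy, e2, e3, this]
  refine wp_ite (fun h => wp_putN ⟨?_, ?_⟩) (fun h => wp_setN ⟨?_, ?_⟩)
  · simpa [BExp.cost, NExp.cost] using htime
  · obtain ⟨k1, k2, k3, k4, -⟩ := hfin { s₅ with
      narr := Function.update s₅.narr 1
        (Function.update (s₅.narr 1) (NExp.eval s₅ (.lit 0)) (NExp.eval s₅ (.var 12))) }
      l5 (by simpa using lo5) (by simpa using hi5) up5
    refine ⟨k4, ?_⟩
    simp only [BExp.Holds, NExp.eval] at h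
    -- The free item is entered at total zero. It keeps the total there, so it is inserted forever,
    -- whatever the rest of the table says.
    obtain ⟨hi, hm0, x, V, hx, hpos⟩ := hf (s₅.nvar 12 - 1) (by omega)
    rw [expectedProfit_eq_top (δ := δ) (V := V) (s := x) (i := s₅.nvar 12 - 1) hI
      (by rw [k1, k2, k3]; exact hR) hi (by rw [k1]; exact hx) (by rw [k2, k3]; exact hm0)
      (by rw [k1, k2, k3]; exact hpos) ?_ (by linarith)]
    · exact le_top
    · simp [decodePolicy, NExp.eval, h.ne']
  · refine le_trans ?_ htime
    simp [BExp.cost, NExp.cost]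
    norm_num
  · simp only [BExp.Holds, NExp.eval, not_lt, Nat.le_zero] at h
    obtain ⟨k1, k2, k3, k4, k5⟩ := hfin { s₅ with
      nvar := Function.update s₅.nvar 13 (NExp.eval s₅ (.lit 0)) }
      (by simpa using l5) lo5 hi5 up5
    refine ⟨k4, ?_⟩
    -- For ε > 1 the factor `ENNReal.ofReal (1 - ε)` is zero.
    rcases lt_or_ge 1 ε with hε1 | hε1
    · rw [ENNReal.ofReal_of_nonpos (by linarith), zero_mul]
      exact zero_le
    have hεe : e = ε := min_eq_left hε1
    rw [hεe] at hδ' hL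
    have hsol := isSolution_of_isBest hI hR hz hb (hn h)
    have h1 : I.capacity + ε / 4 + δ ≤ L * δ :=
      (div_le_iff₀ hδ0).1 (by rw [hL]; exact Nat.le_ceil _)
    have h32 : δ * (32 * (I.capacity + 1)) = ε ^ 3 := by
      rw [hδ']; field_simp
    -- The ceiling costs one more unit. Hence Lδ + ε/4 + δ < C + ε/2 + 3δ, and 32δ ≤ ε³ ≤ ε keeps
    -- this below C + ε.
    have h2 : L * δ < I.capacity + ε / 4 + δ + δ := by
      have : (L : ℝ) < (I.capacity + ε / 4 + δ) / δ + 1 := by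
        rw [hL]; exact Nat.ceil_lt_add_one (by positivity)
      have := mul_lt_mul_of_pos_right this hδ0
      rwa [add_mul, div_mul_cancel₀ _ hδ0.ne', one_mul] at this
    have h3 : 32 * δ ≤ ε ^ 3 := by
      have := mul_nonneg hδ0.le hC
      linarith
    have h4 : ε ^ 3 ≤ ε := by
      have : ε ^ 2 ≤ 1 := pow_le_one₀ hε.le hε1
      nlinarith
    refine IsSolution.opt_le (V := s₅.rarr 4) (δ := δ) ?_ hI (by rw [k1, k2, k3]; exact hR) k5 hδ0
      hε hε1 ?_ ?_ ?_
    · rw [k1, k2, k3]; exact hsol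
    · rw [k1]; exact h1
    · rw [k1]; linarith
    · have : δ * (I.capacity + ε) ≤ δ * (I.capacity + 1) := by gcongr
      linarith

end StochKnapsack
end

theorem mainTheorem9 :
    ∃ (P : RealRAM.Prog) (K k : ℕ),
      ∀ (I : StochKnapsack.Instance) (ε : ℝ), I.Valid → 0 < ε →
        ∃ (t : ℕ) (s : RealRAM.Store),
          RealRAM.Exec P (I.encode ε) t s ∧
          (t : ℝ) ≤ K * I.inputSize * ((1 + I.capacity) * (1 + 1 / ε)) ^ k ∧
          (StochKnapsack.decodePolicy I s).WellFormed I ∧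
          ENNReal.ofReal (1 - ε) * StochKnapsack.OPT I ≤
            (StochKnapsack.decodePolicy I s).expectedProfit I (I.capacity + ε) := by
  refine ⟨StochKnapsack.knapsackScheme, 17500, 3, fun I ε hI hε => ?_⟩
  obtain ⟨t, s, he, ht, h⟩ := StochKnapsack.wp_knapsackScheme hI hε
  exact ⟨t, s, he, by exact_mod_cast ht, h⟩
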